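/- Rings are not assumed to be associative or to have an identity. For a ring $R$ write $(x,y,z)=(xy)z-x(yz)$ and $(x,y)=xy-yx$. The ring $R$ is alternative if $(x,y,y)=0=(y,y,x)$ for all $x,y\in R$. Its commutative center is $Z=\{z\in R : (z,R)=0\}$, and its center $C$ consists of the $c\in Z$ with $(c,R,R)=(R,c,R)=(R,R,c)=0$. A non-zero $r\in R$ is a left (right) zero divisor if $ry=0$ ($yr=0$) for some non-zero $y\in R$. If $R$ has neither left nor right zero divisors and $C\neq 0$, the central quotient $R/\!/C$ is the ring of fractions $r/c$ with $r\in R$, $0\ne c\in C$, where $r/c=s/d$ if and only if $dr=cs$, with the usual addition and multiplication of fractions. An octonion algebra over a field $F$ is an $8$-dimensional (not necessarily associative) $F$-algebra with identity which carries a quadratic form $N$ with nondegenerate polar form such that $N(ab)=N(a)N(b)$ for all $a,b$; it is a division algebra if for all $a\neq 0$ and all $b$ the equations $ax=b$ and $ya=b$ have unique solutions. **Theorem 1.1.** Let $R$ be an alternative ring that is not associative. Assume that 1. every non-zero commutator $(x,y)$ in $R$ fails to be a left zero divisor or fails to be a right zero divisor in $R$; 2. $(xy)z=x(yz)$ whenever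 $x\in R$ and $y,z\in Z$. Then (a) $R$ contains neither left nor right zero divisors. (b) If, in addition, the characteristic of $R$ (the least $n\ge 1$ with $nR=0$, or $0$ if there is none) is not $2$, then $C\neq 0$; the center of $R/\!/C$ is a field, namely the fraction field of $C$ (the canonical map from $C$ to the center of $R/\!/C$ is injective and every element of this center is a fraction of elements of $C$); and $R/\!/C$ is an $8$-dimensional octonion division algebra over its center. -/

import Mathlib

/-!
Alternative rings, zero divisors, the central quotient ring of a ring without zero divisors,
fraction fields of (possibly non-unital) commutative rings, and octonion division algebras.
Rings are neither assumed to be associative nor to have an identity.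
-/

/-- A ring is alternative if `(x, y, y) = 0 = (y, y, x)` for all `x, y`, where
`(x, y, z) = (x y) z - x (y z)` is the associator. -/
def IsAlternativeRing (R : Type*) [NonUnitalNonAssocRing R] : Prop :=
  ∀ x y : R, associator x y y = 0 ∧ associator y y x = 0

section ZeroDivisors

variable {R : Type*} [NonUnitalNonAssocRing R]

/-- `r` is a left zero divisor: it is non-zero and `r * y = 0` for some non-zero `y`. -/
def IsLeftZeroDivisor (r : R) : Prop := r ≠ 0 ∧ ∃ y : R, y ≠ 0 ∧ r * y = 0

/-- `r` is a right zero divisor: it is non-zero and `y * r = 0` for some non-zero `y`. -/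
def IsRightZeroDivisor (r : R) : Prop := r ≠ 0 ∧ ∃ y : R, y ≠ 0 ∧ y * r = 0

/-- The commutative center: the elements that commute with every element.
No condition on associators is imposed. -/
def commutativeCenter (R : Type*) [NonUnitalNonAssocRing R] : Set R :=
  {z | ∀ r : R, z * r = r * z}

end ZeroDivisors

namespace CentralQuotient

section Central

variable {R : Type*} [NonUnitalNonAssocRing R]

theorem central_assoc (c : NonUnitalSubring.center R) (x y : R) :
    (c : R) * x * y = (c : R) * (x * y) := (c.2.left_assoc x y).symm

theorem central_left_comm (c : NonUnitalSubring.center R) (x y : R) :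
    x * ((c : R) * y) = (c : R) * (x * y) := (c.2.left_comm x y).symm

end Central

variable (R : Type*) [NonUnitalNonAssocRing R]

/-- The denominators of the central quotient: the non-zero elements of the center. -/
abbrev Denom : Type _ := {c : NonUnitalSubring.center R // c ≠ 0}

variable {R}

/-- A denominator, viewed as an element of the ring. -/
def Denom.val (c : Denom R) : R := (c.1 : R)

theorem Denom.val_ne_zero (c : Denom R) : c.val ≠ 0 := fun h => c.2 (Subtype.ext h)

theorem Denom.assoc (c : Denom R) (x y : R) : c.val * x * y = c.val * (x * y) :=
  central_assoc c.1 x y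

theorem Denom.left_comm (c : Denom R) (x y : R) : x * (c.val * y) = c.val * (x * y) :=
  central_left_comm c.1 x y

theorem Denom.comm (c : Denom R) (x : R) : x * c.val = c.val * x := (c.1.2.comm x).symm

theorem Denom.left_comm' (c d : Denom R) (x : R) :
    c.val * (d.val * x) = d.val * (c.val * x) := Denom.left_comm d _ _

variable [NoZeroDivisors R]

instance : Mul (Denom R) :=
  ⟨fun c d => ⟨c.1 * d.1, fun h => by
    have h' : c.val * d.val = 0 := congrArg Subtype.val h
    rcases mul_eq_zero.mp h' with h' | h'
    · exact c.val_ne_zero h'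
    · exact d.val_ne_zero h'⟩⟩

theorem Denom.val_mul (c d : Denom R) : (c * d).val = c.val * d.val := rfl

theorem Denom.mul_apply (c d : Denom R) (x : R) :
    (c * d).val * x = c.val * (d.val * x) := Denom.assoc c _ _

theorem Denom.cancel (c : Denom R) {x y : R} (h : c.val * x = c.val * y) : x = y := by
  have h' : c.val * (x - y) = 0 := by rw [mul_sub, h, sub_self]
  rcases mul_eq_zero.mp h' with h' | h'
  · exact absurd h' c.val_ne_zero
  · exact sub_eq_zero.mp h'

variable (R)

/-- The fractions `r / c` and `s / d` are identified when `d r = c s`. -/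
def setoid : Setoid (R × Denom R) where
  r p q := q.2.val * p.1 = p.2.val * q.1
  iseqv :=
    { refl := fun _ => rfl
      symm := fun h => h.symm
      trans := by
        rintro ⟨r, c⟩ ⟨s, d⟩ ⟨t, e⟩ (h₁ : d.val * r = c.val * s) (h₂ : e.val * s = d.val * t)
        change e.val * r = c.val * t
        apply Denom.cancel d
        rw [Denom.left_comm' d e, h₁, Denom.left_comm' e c, h₂, Denom.left_comm' c d] }

end CentralQuotient

/-- The central quotient ring `R // C` of a ring `R` without zero divisors and with center `C`:
the fractions `r / c` with `r ∈ R` and `0 ≠ c ∈ C`. -/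
def CentralQuotient (R : Type*) [NonUnitalNonAssocRing R] [NoZeroDivisors R] : Type _ :=
  Quotient (CentralQuotient.setoid R)

namespace CentralQuotient

variable {R : Type*} [NonUnitalNonAssocRing R] [NoZeroDivisors R]

/-- The fraction `r / c`. -/
def mk (r : R) (c : Denom R) : CentralQuotient R := Quotient.mk (setoid R) (r, c)

theorem mk_eq_mk {r s : R} {c d : Denom R} :
    mk r c = mk s d ↔ d.val * r = c.val * s := Quotient.eq (r := setoid R)

theorem mk_surj (q : CentralQuotient R) : ∃ r c, q = mk r c := by
  induction q using Quotient.inductionOn with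
  | h p => exact ⟨p.1, p.2, rfl⟩

/-- `r / c + s / d = (d r + c s) / (c d)`. -/
instance : Add (CentralQuotient R) :=
  ⟨Quotient.map₂ (fun p q => (q.2.val * p.1 + p.2.val * q.1, p.2 * q.2)) (by
    rintro ⟨r, c⟩ ⟨r', c'⟩ (h : c'.val * r = c.val * r')
      ⟨s, d⟩ ⟨s', d'⟩ (k : d'.val * s = d.val * s')
    change (c' * d').val * (d.val * r + c.val * s) = (c * d).val * (d'.val * r' + c'.val * s')
    simp only [Denom.mul_apply, mul_add]
    congr 1
    · rw [Denom.left_comm' d' d, Denom.left_comm' c' d, Denom.left_comm' c' d', h,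
        Denom.left_comm' d' c, Denom.left_comm' d c]
    · rw [Denom.left_comm' d' c, k, Denom.left_comm' c' c, Denom.left_comm' d c'])⟩

/-- `(r / c) (s / d) = (r s) / (c d)`. -/
instance : Mul (CentralQuotient R) :=
  ⟨Quotient.map₂ (fun p q => (p.1 * q.1, p.2 * q.2)) (by
    rintro ⟨r, c⟩ ⟨r', c'⟩ (h : c'.val * r = c.val * r')
      ⟨s, d⟩ ⟨s', d'⟩ (k : d'.val * s = d.val * s')
    change (c' * d').val * (r * s) = (c * d).val * (r' * s')
    simp only [Denom.mul_apply]
    rw [← Denom.left_comm d' r s, k, Denom.left_comm d r s', Denom.left_comm' c' d,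
      ← Denom.assoc c' r s', h, Denom.assoc, Denom.left_comm' d c])⟩

/-- `-(r / c) = (-r) / c`. -/
instance : Neg (CentralQuotient R) :=
  ⟨Quotient.map (fun p => (-p.1, p.2)) (by
    rintro ⟨r, c⟩ ⟨r', c'⟩ (h : c'.val * r = c.val * r')
    change c'.val * (-r) = c.val * (-r')
    rw [mul_neg, mul_neg, h])⟩

theorem mk_add (r s : R) (c d : Denom R) :
    mk r c + mk s d = mk (d.val * r + c.val * s) (c * d) := rfl

theorem mk_mul (r s : R) (c d : Denom R) : mk r c * mk s d = mk (r * s) (c * d) := rfl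

theorem mk_neg (r : R) (c : Denom R) : -mk r c = mk (-r) c := rfl

section Ring

variable [hC : Nontrivial (NonUnitalSubring.center R)]

instance : Nonempty (Denom R) := by
  obtain ⟨c, hc⟩ := exists_ne (0 : NonUnitalSubring.center R)
  exact ⟨⟨c, hc⟩⟩

/-- An arbitrarily chosen non-zero central element. -/
noncomputable def someDenom (R : Type*) [NonUnitalNonAssocRing R] [NoZeroDivisors R]
    [Nontrivial (NonUnitalSubring.center R)] : Denom R := Classical.arbitrary _

/-- `0 = 0 / c`, for any non-zero central `c`. -/
noncomputable instance : Zero (CentralQuotient R) := ⟨mk 0 (someDenom R)⟩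

/-- `1 = c / c`, for any non-zero central `c`. -/
noncomputable instance : One (CentralQuotient R) := ⟨mk (someDenom R).val (someDenom R)⟩

theorem zero_eq (c : Denom R) : (0 : CentralQuotient R) = mk 0 c :=
  mk_eq_mk.mpr (by rw [mul_zero, mul_zero])

theorem one_eq (c : Denom R) : (1 : CentralQuotient R) = mk c.val c :=
  mk_eq_mk.mpr (Denom.comm _ _)

noncomputable instance : NonAssocRing (CentralQuotient R) where
  add_assoc a b c := by
    obtain ⟨a, x, rfl⟩ := mk_surj a
    obtain ⟨b, y, rfl⟩ := mk_surj b
    obtain ⟨c, z, rfl⟩ := mk_surj c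
    simp only [mk_add, mk_eq_mk, Denom.mul_apply, mul_add, add_assoc]
    simp only [Denom.left_comm' z, Denom.left_comm' y x]
  zero_add a := by
    obtain ⟨a, x, rfl⟩ := mk_surj a
    rw [zero_eq x, mk_add, mk_eq_mk, mul_zero, zero_add, Denom.mul_apply]
  add_zero a := by
    obtain ⟨a, x, rfl⟩ := mk_surj a
    rw [zero_eq x, mk_add, mk_eq_mk, mul_zero, add_zero, Denom.mul_apply]
  add_comm a b := by
    obtain ⟨a, x, rfl⟩ := mk_surj a
    obtain ⟨b, y, rfl⟩ := mk_surj b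
    rw [mk_add, mk_add, mk_eq_mk, Denom.mul_apply, Denom.mul_apply, Denom.left_comm' y x,
      add_comm]
  neg_add_cancel a := by
    obtain ⟨a, x, rfl⟩ := mk_surj a
    rw [mk_neg, mk_add, zero_eq x, mk_eq_mk, mul_neg, neg_add_cancel, mul_zero, mul_zero]
  nsmul := nsmulRec
  zsmul := zsmulRec
  left_distrib a b c := by
    obtain ⟨a, x, rfl⟩ := mk_surj a
    obtain ⟨b, y, rfl⟩ := mk_surj b
    obtain ⟨c, z, rfl⟩ := mk_surj c
    simp only [mk_add, mk_mul, mk_eq_mk, Denom.mul_apply, mul_add, Denom.left_comm _ a]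
    simp only [Denom.left_comm' z, Denom.left_comm' y x]
  right_distrib a b c := by
    obtain ⟨a, x, rfl⟩ := mk_surj a
    obtain ⟨b, y, rfl⟩ := mk_surj b
    obtain ⟨c, z, rfl⟩ := mk_surj c
    simp only [mk_add, mk_mul, mk_eq_mk, Denom.mul_apply, mul_add, add_mul, Denom.assoc]
    simp only [Denom.left_comm' z, Denom.left_comm' y x]
  zero_mul a := by
    obtain ⟨a, x, rfl⟩ := mk_surj a
    rw [zero_eq x, mk_mul, zero_mul, mk_eq_mk, mul_zero, mul_zero]
  mul_zero a := by
    obtain ⟨a, x, rfl⟩ := mk_surj a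
    rw [zero_eq x, mk_mul, mul_zero, mk_eq_mk, mul_zero, mul_zero]
  one_mul a := by
    obtain ⟨a, x, rfl⟩ := mk_surj a
    rw [one_eq x, mk_mul, mk_eq_mk, Denom.mul_apply]
  mul_one a := by
    obtain ⟨a, x, rfl⟩ := mk_surj a
    rw [one_eq x, mk_mul, mk_eq_mk, Denom.mul_apply, Denom.comm]

/-- The canonical map `R → R // C`, `r ↦ (c r) / c` for any non-zero central `c`. -/
noncomputable def of (R : Type*) [NonUnitalNonAssocRing R] [NoZeroDivisors R]
    [Nontrivial (NonUnitalSubring.center R)] : R →ₙ+* CentralQuotient R where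
  toFun r := mk ((someDenom R).val * r) (someDenom R)
  map_zero' := by rw [mul_zero]; rfl
  map_add' r s := by
    rw [mk_add, mk_eq_mk, Denom.mul_apply, mul_add, mul_add, mul_add]
  map_mul' r s := by
    rw [mk_mul, mk_eq_mk, Denom.mul_apply, Denom.assoc, Denom.left_comm _ r]

theorem of_eq (r : R) (c : Denom R) : of R r = mk (c.val * r) c :=
  mk_eq_mk.mpr (Denom.left_comm' _ _ _)

theorem of_mem_center (z : NonUnitalSubring.center R) :
    of R z ∈ Subring.center (CentralQuotient R) := by
  refine ⟨fun a => ?_, fun a b => ?_, fun a b => ?_⟩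
  · obtain ⟨a, x, rfl⟩ := mk_surj a
    have h : (z : R) * a = a * z := z.2.comm a
    change of R z * mk a x = mk a x * of R z
    rw [of_eq _ x, mk_mul, mk_mul, mk_eq_mk, Denom.assoc, Denom.left_comm _ a, h]
  · obtain ⟨a, x, rfl⟩ := mk_surj a
    obtain ⟨b, y, rfl⟩ := mk_surj b
    have h : (z : R) * (a * b) = z * a * b := z.2.left_assoc a b
    rw [of_eq _ x]
    simp only [mk_mul, mk_eq_mk, Denom.mul_apply, Denom.assoc, h]
  · obtain ⟨a, x, rfl⟩ := mk_surj a
    obtain ⟨b, y, rfl⟩ := mk_surj b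
    have h : a * b * (z : R) = a * (b * z) := z.2.right_assoc a b
    rw [of_eq _ x]
    simp only [mk_mul, mk_eq_mk, Denom.mul_apply, Denom.left_comm _ a, Denom.left_comm _ b,
      Denom.left_comm _ (a * b), h]

/-- The center of `R // C` is a commutative (associative) ring. -/
noncomputable instance : CommRing (Subring.center (CentralQuotient R)) where
  __ : NonAssocRing (Subring.center (CentralQuotient R)) := inferInstance
  mul_assoc a b c := Subtype.ext (a.2.left_assoc (b : CentralQuotient R) c).symm
  mul_comm a b := Subtype.ext (a.2.comm (b : CentralQuotient R))

/-- `R // C` is a vector space over its center, which acts by multiplication. -/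
noncomputable instance : Module (Subring.center (CentralQuotient R)) (CentralQuotient R) where
  smul z q := (z : CentralQuotient R) * q
  one_smul q := one_mul q
  mul_smul z w q := (z.2.left_assoc (w : CentralQuotient R) q).symm
  smul_zero z := mul_zero (z : CentralQuotient R)
  smul_add z p q := mul_add (z : CentralQuotient R) p q
  add_smul z w q := add_mul (z : CentralQuotient R) w q
  zero_smul q := zero_mul q

/-- The restriction of the canonical map to the centers, `C → center of R // C`. -/
noncomputable def ofCenter (R : Type*) [NonUnitalNonAssocRing R] [NoZeroDivisors R]
    [Nontrivial (NonUnitalSubring.center R)] :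
    NonUnitalSubring.center R →ₙ+* Subring.center (CentralQuotient R) where
  toFun z := ⟨of R z, of_mem_center z⟩
  map_zero' := Subtype.ext (map_zero (of R))
  map_add' z w := Subtype.ext (map_add (of R) (z : R) w)
  map_mul' z w := Subtype.ext (map_mul (of R) (z : R) w)

end Ring

end CentralQuotient

/-- The homomorphism `f : C → K` exhibits `K` as the fraction field of the commutative ring `C`
(which need not have an identity): `K` is a field, `f` is injective, and every element of `K` is
a fraction `f a / f b` with `a, b ∈ C` and `b ≠ 0`. -/
structure IsFractionFieldMap {C K : Type*} [NonUnitalCommRing C] [CommRing K]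
    (f : C →ₙ+* K) : Prop where
  isField : IsField K
  injective : Function.Injective f
  surj : ∀ k : K, ∃ a b : C, b ≠ 0 ∧ k * f b = f a

/-- An octonion algebra over a field `F`: an `8`-dimensional composition algebra, that is, a
(not necessarily associative) bilinear algebra with identity that carries a multiplicative
quadratic form with nondegenerate polar form. -/
structure IsOctonionAlgebra (F A : Type*) [CommRing F] [NonAssocRing A] [Module F A] : Prop where
  isField : IsField F
  smul_mul : ∀ (t : F) (a b : A), (t • a) * b = t • (a * b)
  mul_smul : ∀ (t : F) (a b : A), a * (t • b) = t • (a * b)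
  finrank_eq : Module.finrank F A = 8
  exists_norm : ∃ N : QuadraticForm F A,
    (∀ a b : A, N (a * b) = N a * N b) ∧ (QuadraticMap.polarBilin N).Nondegenerate

/-- A (not necessarily associative) division ring: it is non-zero, and for `a ≠ 0` the equations
`a x = b` and `y a = b` are uniquely solvable. -/
def IsNonAssocDivisionRing (A : Type*) [NonAssocRing A] : Prop :=
  Nontrivial A ∧ ∀ a b : A, a ≠ 0 → (∃! x : A, a * x = b) ∧ (∃! y : A, y * a = b)

/-! Everything rests on the squares of commutators being central. Write v = [x, y]. The
skew-symmetric Kleinfeld function gives identities by which v anticommutes with every (x, y, z), and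
v² associates with x and with y. If some (v², p, q) were non-zero, the regularity of commutators
would make v² commute with x and y, and then v itself would annihilate (v², p, q) on both sides. So
v² lies in the nucleus (`associator_commutator_sq`), and the nucleus is commutative with everything
(`nucleus_comm`). A similar argument, with the second hypothesis, shows that the commutative center
is the center (`commutativeCenter_associator`), so every non-central x has a non-zero commutator.

Since x[x, y] = [x, xy], the elements v, xv and v + xv are all commutators, and their squares yield
a quadratic equation for x with central coefficients and regular constant term (`exists_quadratic`).
If ab = 0, multiplying the equation of a non-central factor by the other factor annihilates the
latter by that constant term. This is part (a).

For (b), the central quotient is a quadratic alternative algebra over its center, a field of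
characteristic not two. Elements with scalar square, apart from non-zero scalars, form a complement
of the scalars. The projection onto the scalars gives a linear form τ and an anisotropic
multiplicative norm. Non-associativity supplies orthogonal i, j, l whose products give eight
orthogonal vectors. A vector w orthogonal to all eight satisfies 2 i(j(lw)) = 0
(`two_mul_eq_zero_of_anticommute`), so the dimension is exactly eight. -/

/-! ### The Kleinfeld function and additivity of the associator. -/

/-- The Kleinfeld function of a ring. -/
def kleinfeld {R : Type*} [NonUnitalNonAssocRing R] (w x y z : R) : R :=
  associator (w * x) y z - x * associator w y z - associator x y z * w

section Additivity

variable {R : Type*} [NonUnitalNonAssocRing R]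

theorem associator_add_left (x x' y z : R) :
    associator (x + x') y z = associator x y z + associator x' y z := by
  simp only [associator, add_mul]; abel

theorem associator_add_mid (x y y' z : R) :
    associator x (y + y') z = associator x y z + associator x y' z := by
  simp only [associator, add_mul, mul_add]; abel

theorem associator_add_right (x y z z' : R) :
    associator x y (z + z') = associator x y z + associator x y z' := by
  simp only [associator, mul_add]; abel

theorem associator_sub_left (x x' y z : R) :
    associator (x - x') y z = associator x y z - associator x' y z := by
  simp only [associator, sub_mul]; abel

theorem associator_sub_right (x y z z' : R) :
    associator x y (z - z') = associator x y z - associator x y z' := by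
  simp only [associator, mul_sub]; abel

theorem associator_zero_right (x y : R) : associator x y 0 = 0 := by
  simp [associator]

end Additivity

/-! ### Associator and commutator identities in alternative rings. -/

namespace IsAlternativeRing

variable {R : Type*} [NonUnitalNonAssocRing R]

theorem associator_self_left (h : IsAlternativeRing R) (x z : R) : associator x x z = 0 := (h z x).2

theorem associator_self_right (h : IsAlternativeRing R) (x z : R) :
    associator z x x = 0 := (h z x).1

theorem associator_swap_left (h : IsAlternativeRing R) (x y z : R) :
    associator x y z = -associator y x z := by
  have h₁ := h.associator_self_left (x + y) z
  have h₂ := h.associator_self_left x z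
  have h₃ := h.associator_self_left y z
  linear_combination (norm := (simp only [associator, mul_add, add_mul]; abel)) h₁ - h₂ - h₃

theorem associator_swap_right (h : IsAlternativeRing R) (x y z : R) :
    associator x y z = -associator x z y := by
  have h₁ := h.associator_self_right (y + z) x
  have h₂ := h.associator_self_right y x
  have h₃ := h.associator_self_right z x
  linear_combination (norm := (simp only [associator, mul_add, add_mul]; abel)) h₁ - h₂ - h₃

theorem associator_cyclic (h : IsAlternativeRing R) (x y z : R) :
    associator x y z = associator y z x := by
  rw [h.associator_swap_left, h.associator_swap_right, neg_neg]

theorem associator_flexible (h : IsAlternativeRing R) (x y : R) : associator x y x = 0 := by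
  rw [h.associator_cyclic, h.associator_self_right]


theorem kleinfeld_swap_right (h : IsAlternativeRing R) (w x y z : R) :
    kleinfeld w x y z = -kleinfeld w x z y := by
  simp only [kleinfeld, h.associator_swap_right _ z y, mul_neg, neg_mul]
  abel

/-- This is the identity `associator_cocycle` rewritten with the associator cyclic. -/
theorem kleinfeld_alternating_sum (h : IsAlternativeRing R) (w x y z : R) :
    kleinfeld w x y z - kleinfeld x y z w + kleinfeld y z w x
      = (w * associator x y z - associator x y z * w)
        - (x * associator y z w - associator y z w * x)
        + (y * associator z w x - associator z w x * y)
        - (z * associator w x y - associator w x y * z) := by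
  have h₁ := associator_cocycle w x y z
  have e₁ := h.associator_cyclic w (x * y) z
  have e₂ := h.associator_cyclic w x (y * z)
  have e₃ := h.associator_cyclic x (y * z) w
  have e₄ := h.associator_cyclic w y z
  have e₆ := h.associator_swap_left x z w
  have e₇ := h.associator_cyclic y w x
  have e₈ := h.associator_swap_left y w x
  have e₉ := h.associator_cyclic z x w
  have e₁₀ := h.associator_swap_right z x w
  have e₁₁ := h.associator_swap_right w y x
  linear_combination (norm := (simp only [kleinfeld, mul_neg]; abel))
    -h₁ + e₁ - e₂ - e₃ - x * e₄ + y * e₆ - y * e₁₀ - z * e₈ + z * e₁₁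

/-- The right side of `kleinfeld_alternating_sum` changes sign under the 4-cycle, so two consecutive
rotations of it cancel. With `kleinfeld_swap_right`, this makes the function skew-symmetric in all
four arguments. -/
theorem kleinfeld_rotate (h : IsAlternativeRing R) (w x y z : R) :
    kleinfeld w x y z = -kleinfeld x y z w := by
  linear_combination (norm := abel)
    h.kleinfeld_alternating_sum x y z w + h.kleinfeld_alternating_sum y z w x

theorem kleinfeld_swap_left (h : IsAlternativeRing R) (w x y z : R) :
    kleinfeld w x y z = -kleinfeld x w y z := by
  rw [h.kleinfeld_rotate w x y z, h.kleinfeld_rotate x y z w, h.kleinfeld_swap_right,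
    h.kleinfeld_rotate x w y z, h.kleinfeld_rotate w y z x, neg_neg]

theorem kleinfeld_swap_middle (h : IsAlternativeRing R) (w x y z : R) :
    kleinfeld w x y z = -kleinfeld w y x z := by
  rw [h.kleinfeld_rotate w x y z, h.kleinfeld_swap_left x y z w, h.kleinfeld_rotate w y x z]

theorem kleinfeld_eq (h : IsAlternativeRing R) (w x y z : R) :
    kleinfeld w x y z = associator (w * x - x * w) y z + associator (y * z - z * y) w x := by
  have h₁ := h.kleinfeld_alternating_sum w x y z
  have h₂ := h.kleinfeld_swap_left w x y z
  have h₃ := h.kleinfeld_swap_left y z w x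
  have h₄ := h.kleinfeld_rotate w x y z
  have h₅ := h.kleinfeld_rotate x y z w
  have e₁ : associator (w * x - x * w) y z = associator (w * x) y z - associator (x * w) y z := by
    simp only [associator, sub_mul]; abel
  have e₂ : associator (y * z - z * y) w x = associator (y * z) w x - associator (z * y) w x := by
    simp only [associator, sub_mul]; abel
  have u₁ : kleinfeld w x y z - kleinfeld x w y z = associator (w * x) y z - associator (x * w) y z
      - x * associator w y z - associator x y z * w + w * associator x y z
      + associator w y z * x := by
    simp only [kleinfeld]; abel
  have u₂ : kleinfeld y z w x - kleinfeld z y w x = associator (y * z) w x - associator (z * y) w x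
      - z * associator y w x - associator z w x * y + y * associator z w x
      + associator y w x * z := by
    simp only [kleinfeld]; abel
  rw [h.associator_cyclic w y z] at u₁
  rw [h.associator_cyclic y w x] at u₂
  rw [e₁, e₂]
  linear_combination (norm := abel) u₁ + u₂ + h₂ + h₃ - h₁ - h₅

theorem kleinfeld_self_left (h : IsAlternativeRing R) (x y z : R) : kleinfeld x x y z = 0 := by
  rw [h.kleinfeld_eq, sub_self, h.associator_cyclic _ x x, h.associator_self_left]
  simp [associator]

theorem kleinfeld_self_middle (h : IsAlternativeRing R) (w x z : R) : kleinfeld w x x z = 0 := by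
  rw [h.kleinfeld_rotate, h.kleinfeld_self_left, neg_zero]

theorem kleinfeld_self_outer (h : IsAlternativeRing R) (x y z : R) : kleinfeld x y x z = 0 := by
  rw [h.kleinfeld_swap_left, h.kleinfeld_self_middle, neg_zero]

/-- A repeated argument annihilates the Kleinfeld function; this and the next lemmas are such
vanishings written out. They let a repeated entry leave the associator, on the opposite side. -/
theorem associator_mul_self_left (h : IsAlternativeRing R) (x y z : R) :
    associator x (x * y) z = associator x y z * x := by
  have h₁ := h.kleinfeld_self_outer x y z
  rw [kleinfeld, h.associator_self_left, mul_zero, sub_zero, h.associator_swap_left (x * y),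
    h.associator_swap_left y, neg_mul] at h₁
  linear_combination (norm := abel) -h₁

theorem associator_mul_self_right (h : IsAlternativeRing R) (x y z : R) :
    associator x (y * x) z = x * associator x y z := by
  have h₁ := h.kleinfeld_self_middle y x z
  rw [kleinfeld, h.associator_self_left, zero_mul, sub_zero, h.associator_swap_left (y * x),
    h.associator_swap_left y, mul_neg] at h₁
  linear_combination (norm := abel) -h₁

theorem associator_mul_self_left' (h : IsAlternativeRing R) (x y z : R) :
    associator x y (x * z) = associator x y z * x := by
  rw [h.associator_swap_right, h.associator_mul_self_left, h.associator_swap_right x z, neg_mul,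
    neg_neg]

theorem associator_mul_self_right' (h : IsAlternativeRing R) (x y z : R) :
    associator x y (z * x) = x * associator x y z := by
  rw [h.associator_swap_right, h.associator_mul_self_right, h.associator_swap_right x z, mul_neg,
    neg_neg]

theorem associator_mul_self_mid_left (h : IsAlternativeRing R) (x y z : R) :
    associator x y (y * z) = associator x y z * y := by
  rw [h.associator_swap_left, h.associator_mul_self_left', h.associator_swap_left x, neg_mul]

theorem associator_mul_self_mid_right (h : IsAlternativeRing R) (x y z : R) :
    associator x y (z * y) = y * associator x y z := by
  rw [h.associator_swap_left, h.associator_mul_self_right', h.associator_swap_left x, mul_neg]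

theorem associator_sq (h : IsAlternativeRing R) (x y z : R) :
    associator (x * x) y z = x * associator x y z + associator x y z * x := by
  have h₁ := h.kleinfeld_self_left x y z
  rw [kleinfeld] at h₁
  linear_combination (norm := abel) h₁

theorem mul_mul_associator (h : IsAlternativeRing R) (x y z : R) :
    x * y * associator x y z = associator x y (z * (y * x)) := by
  have e : z * (y * x) = z * y * x + associator x y z := by
    rw [← h.associator_cyclic z x y, h.associator_swap_right]
    simp [associator]
  rw [e, associator_add_right, h.associator_mul_self_right', h.associator_mul_self_mid_right,
    associator_apply x y (associator x y z)]
  abel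

theorem associator_mul_mul (h : IsAlternativeRing R) (x y z : R) :
    associator x y z * (y * x) = associator x y (x * y * z) := by
  have e : x * y * z = associator x y z + x * (y * z) := by simp [associator]
  have e' := h.associator_cyclic (associator x y z) y x
  rw [h.associator_swap_left y x, associator_apply (associator x y z)] at e'
  rw [e, associator_add_right, h.associator_mul_self_left', h.associator_mul_self_mid_left]
  linear_combination (norm := abel) -e'

theorem associator_mul_commutator (h : IsAlternativeRing R) (x y z : R) :
    associator x y z * (x * y - y * x) = -associator x y ((x * y - y * x) * z) := by
  have h₁ := h.associator_mul_mul x y z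
  have h₂ := h.associator_mul_mul y x z
  rw [h.associator_swap_left y x, h.associator_swap_left y x, neg_mul, neg_inj] at h₂
  rw [sub_mul, associator_sub_right, mul_sub, h₁, h₂]
  abel

theorem associator_mul_right_self (h : IsAlternativeRing R) (x y : R) :
    associator (x * y) x y = 0 := by
  rw [h.associator_cyclic, h.associator_mul_self_left', h.associator_self_right, zero_mul]

theorem associator_commutator_self (h : IsAlternativeRing R) (x y : R) :
    associator (x * y - y * x) x y = 0 := by
  rw [associator_sub_left, h.associator_mul_right_self, h.associator_swap_right,
    h.associator_mul_right_self, neg_zero, sub_zero]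

theorem commutator_mul_associator (h : IsAlternativeRing R) (x y z : R) :
    (x * y - y * x) * associator x y z = associator x y ((x * y - y * x) * z) := by
  have h₁ := h.kleinfeld_eq z (x * y - y * x) x y
  rw [kleinfeld, h.associator_commutator_self, zero_mul, sub_zero,
    h.associator_flexible, add_zero, associator_sub_left, h.associator_cyclic z x y,
    h.associator_cyclic ((x * y - y * x) * z)] at h₁
  linear_combination (norm := abel) -h₁

theorem associator_anticommutes_commutator (h : IsAlternativeRing R) (x y z : R) :
    associator x y z * (x * y - y * x) + (x * y - y * x) * associator x y z = 0 := by
  rw [h.associator_mul_commutator, h.commutator_mul_associator, neg_add_cancel]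

theorem associator_associator (h : IsAlternativeRing R) (x y z : R) :
    associator x y (associator x y z) = (x * y - y * x) * associator x y z := by
  have h₁ : kleinfeld z (x * y) x y = kleinfeld x y z (x * y) := by
    rw [h.kleinfeld_rotate z, h.kleinfeld_rotate (x * y), neg_neg]
  have h₂ := h.mul_mul_associator y x z
  have h₃ := h.associator_cyclic x y (associator x y z)
  rw [h.associator_swap_left y x, h.associator_swap_left y x, mul_neg, neg_inj] at h₂
  rw [associator_apply y] at h₃
  have h₄ : associator x z (x * y) = -(associator x y z * x) := by
    rw [h.associator_mul_self_left', h.associator_swap_right, neg_mul]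
  have h₅ : associator y z (x * y) = y * associator x y z := by
    rw [h.associator_mul_self_right', ← h.associator_cyclic x]
  rw [kleinfeld, kleinfeld, h.associator_mul_right_self, zero_mul, sub_zero, h.associator_flexible,
    zero_sub, h₄, h₅, h.associator_cyclic z x y, h.associator_cyclic (z * _), ← h₂,
    mul_neg] at h₁
  rw [sub_mul]
  linear_combination (norm := abel) h₃ + h₁

/-- Linearization of `associator_associator` in the second variable. -/
theorem commutator_mul_associator_linearized (h : IsAlternativeRing R) (x y y' z : R) :
    (x * y' - y' * x) * associator x y z + (x * y - y * x) * associator x y' z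
      = associator x y' (associator x y z) + associator x y (associator x y' z) := by
  have h₁ := h.associator_associator x (y + y') z
  have h₂ := h.associator_associator x y z
  have h₃ := h.associator_associator x y' z
  simp only [associator_add_mid, associator_add_right, mul_add, add_mul, sub_mul] at h₁ h₂ h₃ ⊢
  linear_combination (norm := abel) h₂ + h₃ - h₁

theorem associator_anticommutes_linearized (h : IsAlternativeRing R) (x y y' z : R) :
    associator x y z * (x * y' - y' * x) + associator x y' z * (x * y - y * x)
      + (x * y' - y' * x) * associator x y z + (x * y - y * x) * associator x y' z = 0 := by
  have h₁ := h.associator_anticommutes_commutator x (y + y') z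
  have h₂ := h.associator_anticommutes_commutator x y z
  have h₃ := h.associator_anticommutes_commutator x y' z
  simp only [associator_add_mid, mul_add, add_mul, sub_mul, mul_sub] at h₁ h₂ h₃ ⊢
  linear_combination (norm := abel) h₁ - h₂ - h₃

theorem commutator_mul_associator_eq_zero (h : IsAlternativeRing R) {u s : R}
    (hs : ∀ z, associator u s z = 0) (p q : R) : (u * s - s * u) * associator u p q = 0 := by
  have h₁ := h.commutator_mul_associator_linearized u s p q
  rwa [hs, hs, mul_zero, zero_add, associator_zero_right, add_zero] at h₁

theorem associator_mul_commutator_eq_zero (h : IsAlternativeRing R) {u s : R}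
    (hs : ∀ z, associator u s z = 0) (p q : R) : associator u p q * (u * s - s * u) = 0 := by
  have h₁ := h.associator_anticommutes_linearized u s p q
  rwa [hs, h.commutator_mul_associator_eq_zero hs, mul_zero, zero_mul, zero_add, add_zero,
    add_zero] at h₁

theorem associator_mul_left_of_commute (h : IsAlternativeRing R) {u s : R}
    (hs : ∀ z, associator u s z = 0) (hc : u * s = s * u) (p q : R) :
    associator u (s * p) q = associator u p q * s := by
  have h₁ : kleinfeld u s p q = 0 := by
    rw [h.kleinfeld_eq, hc, sub_self, h.associator_cyclic _ u s, hs]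
    simp [associator]
  rw [h.kleinfeld_rotate, neg_eq_zero, kleinfeld, ← h.associator_cyclic u, ← h.associator_cyclic u,
    ← h.associator_cyclic u, hs, mul_zero, sub_zero, sub_eq_zero] at h₁
  exact h₁

theorem associator_mul_right_of_commute (h : IsAlternativeRing R) {u s : R}
    (hs : ∀ z, associator u s z = 0) (hc : u * s = s * u) (p q : R) :
    associator u (p * s) q = s * associator u p q := by
  have h₁ : kleinfeld u s p q = 0 := by
    rw [h.kleinfeld_eq, hc, sub_self, h.associator_cyclic _ u s, hs]
    simp [associator]
  rw [h.kleinfeld_swap_middle, h.kleinfeld_rotate, neg_neg, kleinfeld, ← h.associator_cyclic u,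
    ← h.associator_cyclic u, ← h.associator_cyclic u, hs, zero_mul, sub_zero, sub_eq_zero] at h₁
  exact h₁

/-- Both s and t can be pulled out of (u, ·, ·), always on the opposite side. Pulling them out of
(u, sp, tq) and (u, ps, qt) in either order lets them be interchanged next to (u, p, q). -/
theorem associator_mul_commutator_of_commute (h : IsAlternativeRing R) {u s t : R}
    (hs : ∀ z, associator u s z = 0) (hsc : u * s = s * u)
    (ht : ∀ z, associator u t z = 0) (htc : u * t = t * u) (p q : R) :
    associator u p q * (s * t - t * s) = 0 ∧ (s * t - t * s) * associator u p q = 0 := by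
  have ls := h.associator_mul_left_of_commute hs hsc
  have lt := h.associator_mul_left_of_commute ht htc
  have rs := h.associator_mul_right_of_commute hs hsc
  have rt := h.associator_mul_right_of_commute ht htc
  have sw := h.associator_swap_right u
  have h₁ : associator u p q * t * s = associator u p q * s * t := by
    have h₂ := ls p (t * q)
    rw [sw, lt, sw, ls, sw p (t * q), lt, sw q p] at h₂
    simpa using h₂.symm
  have h₂ : s * (t * associator u p q) = t * (s * associator u p q) := by
    have h₂ := rs p (q * t)
    rw [sw, rt, sw, rs, sw p (q * t), rt, sw q p] at h₂
    simpa using h₂.symm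
  -- Here s and t leave on different sides, which shows that s, t and (u, p, q) associate.
  have h₃ : t * associator u p q * s = t * (associator u p q * s) := by
    have h₂ := ls p (q * t)
    rw [sw, rt, sw, ls, sw p (q * t), rt, sw q p] at h₂
    simpa using h₂.symm
  have h₄ : associator t (associator u p q) s = 0 := by rw [associator, h₃, sub_self]
  have h₅ : associator (associator u p q) s t = 0 := by
    rw [← h.associator_cyclic, h₄]
  have h₆ : associator (associator u p q) t s = 0 := by
    rw [h.associator_swap_right, h₅, neg_zero]
  have h₇ : associator s t (associator u p q) = 0 := by
    rw [← h.associator_cyclic, h₅]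
  have h₈ : associator t s (associator u p q) = 0 := by
    rw [← h.associator_cyclic, h₆]
  rw [associator, sub_eq_zero] at h₅ h₆ h₇ h₈
  constructor
  · rw [mul_sub, ← h₅, ← h₆, h₁, sub_self]
  · rw [sub_mul, h₇, h₈, h₂, sub_self]

theorem associator_commutator_left (h : IsAlternativeRing R) (x y z : R) :
    associator (x * y - y * x) x z = x * associator x y z - associator x y z * x := by
  rw [associator_sub_left, h.associator_swap_left (x * y), h.associator_swap_left (y * x),
    h.associator_mul_self_left, h.associator_mul_self_right]
  abel

/-- The square of a commutator associates with the entries of the commutator. -/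
theorem associator_commutator_sq_left (h : IsAlternativeRing R) (x y z : R) :
    associator ((x * y - y * x) * (x * y - y * x)) x z = 0 := by
  -- With a = (x, y, z), the substitutions z ↦ xz and z ↦ zx show that v anticommutes with ax and
  -- xa, hence with [x, a] = (v, x, z).
  have h₁ := h.associator_anticommutes_commutator x y (x * z)
  have h₂ := h.associator_anticommutes_commutator x y (z * x)
  rw [h.associator_mul_self_left'] at h₁
  rw [h.associator_mul_self_right'] at h₂
  rw [h.associator_sq, h.associator_commutator_left]
  generalize x * y - y * x = v at *
  rw [mul_sub, sub_mul]
  linear_combination (norm := abel) h₂ - h₁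

theorem associator_commutator_sq_right (h : IsAlternativeRing R) (x y z : R) :
    associator ((x * y - y * x) * (x * y - y * x)) y z = 0 := by
  have h₁ := h.associator_commutator_sq_left y x z
  rwa [← neg_sub (x * y), neg_mul_neg] at h₁

end IsAlternativeRing

/-! ### Squares of commutators, the nucleus and the commutative center. -/

/-- A ring has regular commutators if no non-zero commutator is annihilated on both sides by a
non-zero element. -/
def HasRegularCommutators (R : Type*) [NonUnitalNonAssocRing R] : Prop :=
  ∀ x y r : R, (x * y - y * x) * r = 0 → r * (x * y - y * x) = 0 → x * y - y * x = 0 ∨ r = 0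

namespace IsAlternativeRing

variable {R : Type*} [NonUnitalNonAssocRing R]

theorem associator_commutator_sq (h : IsAlternativeRing R) (hR : HasRegularCommutators R)
    (x y p q : R) : associator ((x * y - y * x) * (x * y - y * x)) p q = 0 := by
  by_contra hne
  have hv : x * y - y * x ≠ 0 := fun h0 => hne (by simp [h0, associator])
  have hs := h.associator_commutator_sq_left x y
  have ht := h.associator_commutator_sq_right x y
  -- The commutator [v², s] annihilates (v², p, q) ≠ 0 on both sides, hence vanishes.
  have commutes : ∀ s, (∀ z, associator ((x * y - y * x) * (x * y - y * x)) s z = 0) →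
      (x * y - y * x) * (x * y - y * x) * s = s * ((x * y - y * x) * (x * y - y * x)) := by
    intro s h₁
    exact sub_eq_zero.mp ((hR _ _ _ (h.commutator_mul_associator_eq_zero h₁ p q)
      (h.associator_mul_commutator_eq_zero h₁ p q)).resolve_right hne)
  obtain ⟨h₁, h₂⟩ :=
    h.associator_mul_commutator_of_commute hs (commutes _ hs) ht (commutes _ ht) p q
  exact hne ((hR _ _ _ h₂ h₁).resolve_left hv)

section Nucleus

variable {n : R}

theorem associator_nucleus_mul (hn : ∀ p q, associator n p q = 0) (r s t : R) :
    associator (n * r) s t = n * associator r s t := by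
  have h₁ := associator_cocycle n r s t
  rw [hn, hn, hn, zero_mul] at h₁
  linear_combination (norm := abel) -h₁

theorem associator_mul_nucleus (h : IsAlternativeRing R) (hn : ∀ p q, associator n p q = 0)
    (r s t : R) : associator (r * n) s t = n * associator r s t := by
  have h₁ := associator_cocycle r n s t
  rw [h.associator_swap_left r n, h.associator_swap_left r n, hn, hn, hn, mul_zero, neg_zero,
    zero_mul, h.associator_swap_left r (n * s), associator_nucleus_mul hn,
    h.associator_swap_left s r, mul_neg] at h₁
  linear_combination (norm := abel) -h₁

theorem nucleus_commute_associator (h : IsAlternativeRing R) (hn : ∀ p q, associator n p q = 0)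
    (r s t : R) : n * associator r s t = associator r s t * n := by
  have h₁ : kleinfeld n r s t = 0 := by
    rw [h.kleinfeld_rotate, kleinfeld, ← h.associator_cyclic n, ← h.associator_cyclic n,
      ← h.associator_cyclic n, hn, hn, hn]
    simp
  rw [kleinfeld, hn, associator_nucleus_mul hn, mul_zero, sub_zero] at h₁
  exact sub_eq_zero.mp h₁

theorem commutator_nucleus (h : IsAlternativeRing R) (hn : ∀ p q, associator n p q = 0)
    (r s t : R) : associator (n * r - r * n) s t = 0 := by
  rw [associator_sub_left, associator_nucleus_mul hn, h.associator_mul_nucleus hn, sub_self]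

/-- In the nucleus the derivation rule [n, rs] = [n, r]s + r[n, s] holds. Its associator with s and
t leaves only the second term, as (s, s, t) = 0. -/
theorem nucleus_associator_mul_commutator (h : IsAlternativeRing R)
    (hn : ∀ p q, associator n p q = 0) (r s t : R) :
    associator r s t * (n * s - s * n) = 0 ∧ (n * s - s * n) * associator r s t = 0 := by
  have hm := h.commutator_nucleus hn
  have e : n * (r * s) - r * s * n = (n * r - r * n) * s + r * (n * s - s * n) := by
    have h₁ := hn r s
    have h₂ : associator r n s = 0 := by rw [h.associator_swap_left, hn, neg_zero]
    have h₃ : associator r s n = 0 := by rw [← h.associator_cyclic, hn]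
    simp only [associator] at h₁ h₂ h₃
    simp only [mul_sub, sub_mul]
    linear_combination (norm := abel) h₂ - h₁ - h₃
  have h₁ := hm (r * s) s t
  rw [e, associator_add_left, associator_nucleus_mul (hm r), h.associator_self_left, mul_zero,
    zero_add, h.associator_mul_nucleus (hm s)] at h₁
  exact ⟨by rw [← h.nucleus_commute_associator (hm s), h₁], h₁⟩

end Nucleus

theorem nucleus_comm (h : IsAlternativeRing R) (hR : HasRegularCommutators R)
    (hna : ∃ x y z : R, associator x y z ≠ 0) {n : R}
    (hn : ∀ p q, associator n p q = 0) (s : R) : n * s = s * n := by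
  have key : ∀ s, (∃ p q, associator s p q ≠ 0) → n * s = s * n := by
    rintro s ⟨p, q, hpq⟩
    have h₁ := h.nucleus_associator_mul_commutator hn p s q
    have h₂ : associator p s q ≠ 0 := by rwa [h.associator_swap_left, neg_ne_zero]
    exact sub_eq_zero.mp ((hR _ _ _ h₁.2 h₁.1).resolve_right h₂)
  by_cases hs : ∃ p q, associator s p q ≠ 0
  · exact key s hs
  · push Not at hs
    obtain ⟨x, y, z, hx⟩ := hna
    -- A nuclear s becomes non-nuclear after adding a non-nuclear x, and n commutes with both x and
    -- s + x.
    have h₁ := key x ⟨y, z, hx⟩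
    have h₂ := key (s + x) ⟨y, z, by rwa [associator_add_left, hs, zero_add]⟩
    rw [mul_add, add_mul, h₁] at h₂
    exact add_right_cancel h₂

theorem commutator_mul_eq (h : IsAlternativeRing R) (x y z : R) :
    x * y * z - z * (x * y) = x * (y * z - z * y) + (x * z - z * x) * y
      + 3 • associator x y z := by
  have h₁ := h.associator_cyclic x y z
  have h₂ := h.associator_cyclic z x y
  have h₃ := h.associator_swap_right x y z
  have h₄ : associator x y z - associator x z y + associator z x y
      = x * y * z - z * (x * y) - x * (y * z - z * y) - (x * z - z * x) * y := by
    simp only [associator, mul_sub, sub_mul]; abel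
  linear_combination (norm := abel) h₂ - h₃ - h₄

theorem commutativeCenter_associator (h : IsAlternativeRing R) (hR : HasRegularCommutators R)
    (hassoc : ∀ x : R, ∀ y ∈ commutativeCenter R, ∀ z ∈ commutativeCenter R,
      (x * y) * z = x * (y * z)) {z : R} (hz : z ∈ commutativeCenter R) (x w : R) :
    associator z x w = 0 := by
  -- For central-commuting z, the vanishing Kleinfeld value at (z, x, x, w) reduces to ([x, w], z,
  -- x) = 0.
  have comm : ∀ x w, x * associator x w z = associator x w z * x := by
    intro x w
    have h₁ := h.kleinfeld_eq z x x w
    rw [h.kleinfeld_self_middle, hz x, sub_self, h.associator_swap_right _ z x,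
      h.associator_commutator_left] at h₁
    simp only [associator, zero_mul, sub_self, zero_add, zero_eq_neg, sub_eq_zero] at h₁ ⊢
    exact h₁
  -- For p = (x, w, z), one finds 3p = 0, and [x, w] both commutes and anticommutes with p. So 2[x,
  -- w]p = 0 = 3[x, w]p, and [x, w] annihilates p on both sides.
  have key : ∀ x w, x * w - w * x ≠ 0 → associator x w z = 0 := by
    intro x w hv
    have three : 3 • associator x w z = 0 := by
      have h₁ := h.commutator_mul_eq x w z
      rw [← hz, ← hz w, ← hz x, sub_self, sub_self, sub_self, mul_zero, zero_mul, zero_add,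
        zero_add] at h₁
      exact h₁.symm
    have cx := comm x w
    have cw : w * associator x w z = associator x w z * w := by
      have h₁ := comm w x
      rwa [h.associator_swap_left, mul_neg, neg_mul, neg_inj] at h₁
    have hp := h.associator_anticommutes_commutator x w z
    generalize associator x w z = p at *
    have three' : ∀ a b, 3 • associator a b p = 0 := fun a b => by
      rw [show 3 • associator a b p = associator a b (3 • p) by
        rw [succ_nsmul, two_nsmul, succ_nsmul, two_nsmul, associator_add_right,
          associator_add_right], three, associator_zero_right]
    have h₁ := h.commutator_mul_eq x w p
    have h₂ := h.commutator_mul_eq w x p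
    rw [three', cx, cw, sub_self, sub_self, mul_zero, zero_mul, zero_add, zero_add] at h₁ h₂
    have h₃ : (x * w - w * x) * p = p * (x * w - w * x) := by
      rw [mul_sub, sub_mul, sub_eq_zero.mp h₁, sub_eq_zero.mp h₂]
    rw [← h₃] at hp
    have h₄ : (x * w - w * x) * (3 • p) = 0 := by rw [three, mul_zero]
    rw [succ_nsmul, two_nsmul, mul_add, mul_add, hp, zero_add] at h₄
    exact (hR x w p h₄ (h₃ ▸ h₄)).resolve_left hv
  by_cases hx : ∃ w, x * w - w * x ≠ 0
  · obtain ⟨y, hy⟩ := hx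
    rw [h.associator_cyclic]
    by_cases hw : x * w - w * x = 0
    · have h₁ : x * (w + y) - (w + y) * x ≠ 0 := by
        intro h₁
        apply hy
        rw [mul_add, add_mul] at h₁
        linear_combination (norm := abel) h₁ - hw
      have h₂ := key _ _ h₁
      rwa [associator_add_mid, key _ _ hy, add_zero] at h₂
    · exact key x w hw
  · push Not at hx
    have h₁ := hassoc w x (fun r => sub_eq_zero.mp (hx r)) z hz
    rw [h.associator_swap_left, h.associator_cyclic, h.associator_cyclic, neg_eq_zero]
    exact sub_eq_zero.mpr h₁

end IsAlternativeRing

/-! ### Quadratic equations over the center and the absence of zero divisors. -/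

namespace IsAlternativeRing

variable {R : Type*} [NonUnitalNonAssocRing R]

theorem mem_center (h : IsAlternativeRing R) {z : R} (hc : ∀ r, z * r = r * z)
    (hn : ∀ p q, associator z p q = 0) : z ∈ NonUnitalSubring.center R := by
  refine ⟨hc, fun p q => (sub_eq_zero.mp (hn p q)).symm, fun p q => sub_eq_zero.mp ?_⟩
  have h₁ := hn p q
  rwa [h.associator_cyclic] at h₁

theorem commutator_sq_mem_center (h : IsAlternativeRing R) (hR : HasRegularCommutators R)
    (hna : ∃ x y z : R, associator x y z ≠ 0) (x y : R) :
    (x * y - y * x) * (x * y - y * x) ∈ NonUnitalSubring.center R :=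
  h.mem_center (h.nucleus_comm hR hna (h.associator_commutator_sq hR x y))
    (h.associator_commutator_sq hR x y)

theorem exists_commutator_ne_zero (h : IsAlternativeRing R) (hR : HasRegularCommutators R)
    (hassoc : ∀ x : R, ∀ y ∈ commutativeCenter R, ∀ z ∈ commutativeCenter R,
      (x * y) * z = x * (y * z)) {x : R} (hx : x ∉ NonUnitalSubring.center R) :
    ∃ y, x * y - y * x ≠ 0 := by
  by_contra! hc
  have hz : x ∈ commutativeCenter R := fun r => sub_eq_zero.mp (hc r)
  exact hx (h.mem_center hz (h.commutativeCenter_associator hR hassoc hz))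

theorem commutator_self_mul (h : IsAlternativeRing R) (x y : R) :
    x * (x * y) - x * y * x = x * (x * y - y * x) := by
  have h₁ := h.associator_flexible x y
  rw [associator] at h₁
  rw [mul_sub]
  linear_combination (norm := abel) -h₁

theorem commutator_mul_self (h : IsAlternativeRing R) (x y : R) :
    x * (y * x) - y * x * x = (x * y - y * x) * x := by
  have h₁ := h.associator_flexible x y
  rw [associator] at h₁
  rw [sub_mul]
  linear_combination (norm := abel) -h₁

theorem eq_zero_of_commutator_sq_eq_zero (hR : HasRegularCommutators R) {x y : R}
    (hv : (x * y - y * x) * (x * y - y * x) = 0) : x * y - y * x = 0 :=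
  (hR x y _ hv hv).elim id id

/-- As v² is central, v(vr) = 0 and (rv)v = 0 both hold, so v can be cancelled twice on whichever
side it is regular. -/
theorem eq_zero_of_commutator_sq_mul_eq_zero (h : IsAlternativeRing R)
    (hcomm : ∀ x y : R, x * y - y * x ≠ 0 →
      ¬ IsLeftZeroDivisor (x * y - y * x) ∨ ¬ IsRightZeroDivisor (x * y - y * x))
    (hsq : ∀ x y : R, (x * y - y * x) * (x * y - y * x) ∈ NonUnitalSubring.center R)
    {x y r : R} (hv : x * y - y * x ≠ 0) (hr : (x * y - y * x) * (x * y - y * x) * r = 0) :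
    r = 0 := by
  have hr' : r * ((x * y - y * x) * (x * y - y * x)) = 0 := (hsq x y).comm r ▸ hr
  have h₁ := hcomm x y hv
  generalize x * y - y * x = v at *
  have e₁ : v * (v * r) = 0 := by rw [← hr]; exact (sub_eq_zero.mp (h.associator_self_left v
      r)).symm
  have e₂ : r * v * v = 0 := by rw [← hr']; exact sub_eq_zero.mp (h.associator_self_right v r)
  by_contra hne
  rcases h₁ with h₁ | h₁
  · have : ∀ s, v * s = 0 → s = 0 := fun s hs => by_contra fun h0 => h₁ ⟨hv, s, h0, hs⟩
    exact hne (this _ (this _ e₁))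
  · have : ∀ s, s * v = 0 → s = 0 := fun s hs => by_contra fun h0 => h₁ ⟨hv, s, h0, hs⟩
    exact hne (this _ (this _ e₂))

theorem self_mul_commutator_ne_zero (h : IsAlternativeRing R) (hR : HasRegularCommutators R)
    {x y : R} (hv : x * y - y * x ≠ 0) : x * (x * y - y * x) ≠ 0 := by
  intro h0
  -- vx = [x, yx] is a commutator, with square (v(xv))x = 0.
  have h₁ : (x * y - y * x) * x = 0 := by
    have h₂ : (x * (y * x) - y * x * x) * (x * (y * x) - y * x * x) = 0 := by
      rw [h.commutator_mul_self]
      generalize x * y - y * x = v at *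
      have h₃ := h.associator_mul_right_self v x
      have h₄ := h.associator_flexible v x
      rw [associator, sub_eq_zero] at h₃ h₄
      rw [← h₃, h₄, h0, mul_zero, zero_mul]
    rw [← h.commutator_mul_self]
    exact eq_zero_of_commutator_sq_eq_zero hR h₂
  rcases hR x y x h₁ h0 with h₂ | h₂
  · exact hv h₂
  · exact hv (by rw [h₂, zero_mul, mul_zero, sub_zero])

/-- An element that is not central is a root of a quadratic polynomial whose coefficients are
central and whose constant coefficient is the square of a commutator. -/
theorem exists_quadratic (h : IsAlternativeRing R)
    (hcomm : ∀ x y : R, x * y - y * x ≠ 0 →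
      ¬ IsLeftZeroDivisor (x * y - y * x) ∨ ¬ IsRightZeroDivisor (x * y - y * x))
    (hsq : ∀ x y : R, (x * y - y * x) * (x * y - y * x) ∈ NonUnitalSubring.center R)
    {x y : R} (hv : x * y - y * x ≠ 0) :
    ∃ c ∈ NonUnitalSubring.center R, ∃ m ∈ NonUnitalSubring.center R,
      c ≠ 0 ∧ c * (x * x) = m * x - x * (x * y - y * x) * (x * (x * y - y * x)) := by
  have hc := hsq x y
  have hn := hsq x (x * y)
  -- The commutators of x with y, xy and y + xy are v, xv and v + xv. Polarizing their squares makes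
  -- m = v(xv) + (xv)v central.
  have hs := hsq x (y + x * y)
  have hreg := @eq_zero_of_commutator_sq_mul_eq_zero _ _ h hcomm hsq x y
  have e : x * (y + x * y) - (y + x * y) * x = (x * y - y * x) + x * (x * y - y * x) := by
    rw [← h.commutator_self_mul, mul_add, add_mul]; abel
  rw [e] at hs
  rw [h.commutator_self_mul] at hn
  generalize x * y - y * x = v at *
  have hm : v * (x * v) + x * v * v ∈ NonUnitalSubring.center R := by
    have := sub_mem (sub_mem hs hc) hn
    convert this using 1
    simp only [mul_add, add_mul]; abel
  have cancel : ∀ a b, v * v * a = v * v * b → a = b := fun a b hab =>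
    sub_eq_zero.mp (hreg hv (by rw [mul_sub, hab, sub_self]))
  refine ⟨v * v, hc, _, hm, fun h0 => hv (hreg hv (by rw [h0, zero_mul])), cancel _ _ ?_⟩
  have k₁ : x * v * v = v * v * x := by
    rw [← (hc.comm x).eq.symm]; exact sub_eq_zero.mp (h.associator_self_right v x)
  have k₂ : v * (x * v) = v * x * v := (sub_eq_zero.mp (h.associator_flexible v x)).symm
  have k₃ : v * x * v * v = v * v * (v * x) := by
    rw [hc.comm (v * x)]; exact sub_eq_zero.mp (h.associator_self_right v _)
  have k₄ : x * x * v * v = v * v * (x * x) := by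
    rw [hc.comm (x * x)]; exact sub_eq_zero.mp (h.associator_self_right v _)
  have k₅ : x * (x * v) = x * x * v := (sub_eq_zero.mp (h.associator_self_left x v)).symm
  have k₆ : x * v * (x * v) = x * (v * x) * v := by
    have h₁ := h.associator_mul_right_self x v
    have h₂ := h.associator_flexible x v
    rw [associator, sub_eq_zero] at h₁ h₂
    rw [← h₁, h₂]
  generalize hm' : v * (x * v) + x * v * v = m at *
  -- Multiplying by x on the left and then by v on the right yields the quadratic equation
  -- multiplied by the regular v².
  have k₇ : m * v = v * v * (v * x) + v * v * (x * v) := by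
    rw [← hm', add_mul, k₂, k₃, k₁, ← hc.left_assoc x v]
  have k₈ : v * v * (x * (v * x)) = m * (x * v) - v * v * (x * x * v) := by
    rw [hc.left_comm, eq_sub_of_add_eq k₇.symm, mul_sub, ← hm.left_comm, ← hc.left_comm, k₅]
  have k₉ : v * v * (x * v * (x * v)) = m * (v * v * x) - v * v * (v * v * (x * x)) := by
    rw [k₆, hc.left_assoc, k₈, sub_mul, ← hm.left_assoc, ← hc.left_assoc, k₁, k₄]
  rw [mul_sub, k₉, hc.left_comm m x]
  abel

theorem mul_eq_zero_of_regular (h : IsAlternativeRing R)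
    (hcomm : ∀ x y : R, x * y - y * x ≠ 0 →
      ¬ IsLeftZeroDivisor (x * y - y * x) ∨ ¬ IsRightZeroDivisor (x * y - y * x))
    (hna : ∃ x y z : R, associator x y z ≠ 0)
    (hassoc : ∀ x : R, ∀ y ∈ commutativeCenter R, ∀ z ∈ commutativeCenter R,
      (x * y) * z = x * (y * z)) {a b : R} (hab : a * b = 0) : a = 0 ∨ b = 0 := by
  have hR : HasRegularCommutators R := by
    intro x y r h₁ h₂
    by_contra! hne
    rcases hcomm x y hne.1 with h₃ | h₃
    · exact h₃ ⟨hne.1, r, hne.2, h₁⟩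
    · exact h₃ ⟨hne.1, r, hne.2, h₂⟩
  have hsq := h.commutator_sq_mem_center hR hna
  have hq : ∀ x ∉ NonUnitalSubring.center R,
      ∃ c ∈ NonUnitalSubring.center R, ∃ m ∈ NonUnitalSubring.center R, ∃ n,
        c * (x * x) = m * x - n ∧ n ∈ NonUnitalSubring.center R ∧ ∀ r, n * r = 0 → r = 0 := by
    intro x hx
    obtain ⟨y, hv⟩ := h.exists_commutator_ne_zero hR hassoc hx
    obtain ⟨c, hc, m, hm, -, e⟩ := h.exists_quadratic hcomm hsq hv
    have hw := h.self_mul_commutator_ne_zero hR hv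
    rw [← h.commutator_self_mul] at e hw
    exact ⟨c, hc, m, hm, _, e, hsq x (x * y),
      fun r => h.eq_zero_of_commutator_sq_mul_eq_zero hcomm hsq hw⟩
  by_cases ha : a ∈ NonUnitalSubring.center R
  · by_cases hb : b ∈ NonUnitalSubring.center R
    · by_contra! hne
      obtain ⟨x, y, hv⟩ : ∃ x y : R, x * y - y * x ≠ 0 := by
        by_contra! hc
        -- If all commutators vanished, every element would be in the commutative center, hence in
        -- the nucleus.
        obtain ⟨p, q, r, hp⟩ := hna
        exact hp (h.commutativeCenter_associator hR hassoc (fun s => sub_eq_zero.mp (hc p s)) q r)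
      -- For central a and b, regularity is applied to a[x, y] = [ax, y], which b annihilates.
      have e : a * x * y - y * (a * x) = a * (x * y - y * x) := by
        rw [mul_sub, ← ha.left_assoc, ha.left_comm y x]
      have h₁ : a * (x * y - y * x) * b = 0 := by
        rw [← ha.left_assoc, (hb.comm _).symm.eq, ha.left_assoc, hab, zero_mul]
      rcases hR (a * x) y b (e ▸ h₁) (by rw [e, hb.comm, h₁]) with h₂ | h₂
      · rw [e] at h₂
        exact (hR x y a (by rw [← ha.comm, h₂]) h₂).elim hv hne.1
      · exact hne.2 h₂
    · obtain ⟨c, hc, m, hm, n, e, hn, hreg⟩ := hq b hb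
      left
      apply hreg
      have e' : n = m * b - c * (b * b) := by rw [e]; abel
      have h₁ := sub_eq_zero.mp (h.associator_self_right b a)
      rw [hn.comm, e', mul_sub, ← hm.left_comm, ← hc.left_comm, ← h₁, hab, zero_mul, mul_zero,
        mul_zero, sub_zero]
  · obtain ⟨c, hc, m, hm, n, e, hn, hreg⟩ := hq a ha
    right
    apply hreg
    have e' : n = m * a - c * (a * a) := by rw [e]; abel
    have h₁ := sub_eq_zero.mp (h.associator_self_left a b)
    rw [e', sub_mul, ← hm.left_assoc, ← hc.left_assoc, h₁, hab, mul_zero, mul_zero, mul_zero,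
      sub_zero]

end IsAlternativeRing

/-! ### Imaginary elements and the trace of a quadratic algebra. -/

/-- An alternative algebra without zero divisors over a field of characteristic not two, in which
every element is a root of a quadratic polynomial over the field and in which the squares of
commutators are scalars. -/
structure IsQuadraticAlternative (F A : Type*) [Field F] [NonAssocRing A] [Module F A] : Prop where
  isAlternativeRing : IsAlternativeRing A
  two_ne_zero : (2 : F) ≠ 0
  eq_zero_or_eq_zero : ∀ a b : A, a * b = 0 → a = 0 ∨ b = 0
  exists_quadratic : ∀ x : A, ∃ t : F, x * x - t • x ∈ Submodule.span F {(1 : A)}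
  commutator_sq : ∀ x y : A,
    (x * y - y * x) * (x * y - y * x) ∈ Submodule.span F {(1 : A)}

namespace IsQuadraticAlternative

variable {F A : Type*} [Field F] [NonAssocRing A] [Module F A]

/-- The imaginary elements of an algebra: those with scalar square that are not themselves non-zero
scalars. -/
def IsImaginary (F : Type*) {A : Type*} [Field F] [NonAssocRing A] [Module F A] (x : A) : Prop :=
  x * x ∈ Submodule.span F {(1 : A)} ∧ (x ∈ Submodule.span F {(1 : A)} → x = 0)

theorem mem_of_smul_mem {x : A} {c : F} (hx : c • x ∈ Submodule.span F {(1 : A)}) :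
    c = 0 ∨ x ∈ Submodule.span F {(1 : A)} := by
  by_cases hc : c = 0
  · exact Or.inl hc
  · exact Or.inr ((Submodule.smul_mem_iff _ hc).mp hx)

variable [IsScalarTower F A A] [SMulCommClass F A A]

theorem IsImaginary.smul {x : A} (hx : IsImaginary F x) (c : F) : IsImaginary F (c • x) := by
  refine ⟨?_, fun h => ?_⟩
  · rw [smul_mul_assoc, mul_smul_comm]
    exact Submodule.smul_mem _ _ (Submodule.smul_mem _ _ hx.1)
  · rcases mem_of_smul_mem h with h | h
    · rw [h, zero_smul]
    · rw [hx.2 h, smul_zero]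

theorem add_sq_mem (h : IsQuadraticAlternative F A) {x y : A} (hx : IsImaginary F x)
    (hy : IsImaginary F y) : (x + y) * (x + y) ∈ Submodule.span F {(1 : A)} := by
  by_cases hxK : x ∈ Submodule.span F {(1 : A)}
  · rw [hx.2 hxK, zero_add]; exact hy.1
  obtain ⟨t, ht⟩ := h.exists_quadratic (x + y)
  obtain ⟨t', ht'⟩ := h.exists_quadratic (x - y)
  -- Parallelogram law: (x + y)² + (x - y)² = 2x² + 2y² is a scalar.
  have h₁ : (t + t') • x + (t - t') • y ∈ Submodule.span F {(1 : A)} := by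
    have := sub_mem (add_mem (add_mem hx.1 hx.1) (add_mem hy.1 hy.1)) (add_mem ht ht')
    convert this using 1
    simp only [mul_add, add_mul, mul_sub, sub_mul, smul_add, smul_sub, add_smul, sub_smul]
    abel
  by_cases htt : t - t' = 0
  · rw [htt, zero_smul, add_zero, ← sub_eq_zero.mp htt, ← two_mul] at h₁
    rcases mem_of_smul_mem h₁ with h₂ | h₂
    · rw [(mul_eq_zero.mp h₂).resolve_left h.two_ne_zero, zero_smul, sub_zero] at ht
      exact ht
    · exact absurd h₂ hxK
  · have h₂ := Submodule.smul_mem _ (t - t')⁻¹ h₁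
    rw [smul_add, smul_smul, smul_smul, inv_mul_cancel₀ htt, one_smul] at h₂
    generalize (t - t')⁻¹ * (t + t') = β at h₂
    obtain ⟨c, hc⟩ := Submodule.mem_span_singleton.mp h₂
    have hyx : y = c • 1 - β • x := by rw [hc]; abel
    -- Since y = c - βx has scalar square, β = 0 or c = 0.
    have h₃ : (2 * (β * c)) • x ∈ Submodule.span F {(1 : A)} := by
      have hK : c • (c • (1 : A)) ∈ Submodule.span F {(1 : A)} :=
        Submodule.smul_mem _ _ (Submodule.smul_mem _ _ (Submodule.mem_span_singleton_self _))
      have hK' : β • β • (x * x) ∈ Submodule.span F {(1 : A)} :=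
        Submodule.smul_mem _ _ (Submodule.smul_mem _ _ hx.1)
      have := sub_mem (add_mem hK hK') hy.1
      convert this using 1
      rw [hyx]
      simp only [mul_sub, sub_mul, smul_mul_assoc, mul_smul_comm, one_mul, mul_one]
      module
    rcases mem_of_smul_mem h₃ with h₄ | h₄
    · rcases mul_eq_zero.mp ((mul_eq_zero.mp h₄).resolve_left h.two_ne_zero) with h₅ | h₅
      · have h₆ : y ∈ Submodule.span F {(1 : A)} := by
          rw [hyx, h₅, zero_smul, sub_zero]
          exact Submodule.smul_mem _ _ (Submodule.mem_span_singleton_self _)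
        rw [hy.2 h₆, add_zero]; exact hx.1
      · have h₆ : x + y = (1 - β) • x := by
          rw [hyx, h₅, zero_smul, zero_sub, sub_smul, one_smul, sub_eq_add_neg]
        rw [h₆]
        exact (hx.smul _).1
    · exact absurd h₄ hxK

theorem isImaginary_add (h : IsQuadraticAlternative F A) {x y : A} (hx : IsImaginary F x)
    (hy : IsImaginary F y) : IsImaginary F (x + y) := by
  refine ⟨h.add_sq_mem hx hy, fun hxy => ?_⟩
  obtain ⟨s, hs⟩ := Submodule.mem_span_singleton.mp hxy
  have hyx : y = s • 1 - x := by rw [hs]; abel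
  have h₁ : (2 * s) • x ∈ Submodule.span F {(1 : A)} := by
    have hK : s • (s • (1 : A)) ∈ Submodule.span F {(1 : A)} :=
      Submodule.smul_mem _ _ (Submodule.smul_mem _ _ (Submodule.mem_span_singleton_self _))
    have := sub_mem (add_mem hK hx.1) hy.1
    convert this using 1
    rw [hyx]
    simp only [mul_sub, sub_mul, smul_mul_assoc, mul_smul_comm, one_mul, mul_one]
    module
  rcases mem_of_smul_mem h₁ with h₂ | h₂
  · rw [← hs, (mul_eq_zero.mp h₂).resolve_left h.two_ne_zero, zero_smul]
  · rw [hx.2 h₂, zero_add]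
    rw [hx.2 h₂, zero_add] at hxy
    exact hy.2 hxy

theorem exists_isImaginary_sub (h : IsQuadraticAlternative F A) (x : A) :
    ∃ t : F, IsImaginary F (x - t • 1) := by
  by_cases hx : x ∈ Submodule.span F {(1 : A)}
  · obtain ⟨s, hs⟩ := Submodule.mem_span_singleton.mp hx
    exact ⟨s, by simp [IsImaginary, hs]⟩
  · obtain ⟨t, ht⟩ := h.exists_quadratic x
    have h1 := Submodule.mem_span_singleton_self (R := F) (1 : A)
    -- Completing the square.
    refine ⟨t / 2, ?_, fun h₁ => ?_⟩
    · have := add_mem ht (Submodule.smul_mem _ (t / 2) (Submodule.smul_mem _ (t / 2) h1))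
      convert this using 1
      have h₂ : t • x = (t / 2) • x + (t / 2) • x := by
        rw [← add_smul, ← two_mul, mul_div_cancel₀ _ h.two_ne_zero]
      rw [h₂]
      simp only [mul_sub, sub_mul, smul_mul_assoc, mul_smul_comm, one_mul, mul_one]
      module
    · have := add_mem h₁ (Submodule.smul_mem _ (t / 2) h1)
      rw [sub_add_cancel] at this
      exact absurd this hx

theorem isImaginary_unique (h : IsQuadraticAlternative F A) [Nontrivial A] {x : A} {s t : F}
    (hs : IsImaginary F (x - s • 1)) (ht : IsImaginary F (x - t • 1)) : s = t := by
  have h₁ := h.isImaginary_add hs (ht.smul (-1))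
  have h₂ : x - s • 1 + (-1 : F) • (x - t • 1) = (t - s) • (1 : A) := by
    rw [neg_smul, one_smul, sub_smul]; abel
  rw [h₂] at h₁
  have h₃ := h₁.2 (Submodule.smul_mem _ _ (Submodule.mem_span_singleton_self _))
  rcases smul_eq_zero.mp h₃ with h₄ | h₄
  · exact (sub_eq_zero.mp h₄).symm
  · exact absurd h₄ one_ne_zero

/-- There is a linear form whose kernel consists of the imaginary elements. -/
theorem exists_trace (h : IsQuadraticAlternative F A) [Nontrivial A] :
    ∃ τ : A →ₗ[F] F, ∀ x, IsImaginary F (x - τ x • 1) := by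
  choose τ hτ using h.exists_isImaginary_sub
  -- Linearity follows from the uniqueness of the scalar part.
  refine ⟨⟨⟨τ, fun x y => ?_⟩, fun c x => ?_⟩, hτ⟩
  · refine h.isImaginary_unique (hτ _) ?_
    convert h.isImaginary_add (hτ x) (hτ y) using 1
    rw [add_smul]; abel
  · refine h.isImaginary_unique (hτ _) ?_
    convert (hτ x).smul c using 1
    rw [smul_sub, smul_smul]; rfl

end IsQuadraticAlternative

/-! ### Anticommuting elements in alternative rings. -/

namespace IsAlternativeRing

variable {R : Type*} [NonUnitalNonAssocRing R]

theorem mul_mul_of_anticommute (h : IsAlternativeRing R) (a : R) {b p : R}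
    (hbp : b * p + p * b = 0) : a * b * p = -(a * p * b) := by
  have h₁ := h.associator_swap_right a b p
  have h₂ : a * (b * p) + a * (p * b) = 0 := by rw [← mul_add, hbp, mul_zero]
  simp only [associator] at h₁
  linear_combination (norm := abel) h₁ + h₂

theorem mul_mul_of_anticommute' (h : IsAlternativeRing R) {a b p : R}
    (hap : a * p + p * a = 0) (hbp : b * p + p * b = 0) (habp : a * b * p + p * (a * b) = 0) :
    a * (b * p) = -(a * b * p) := by
  have h₁ := h.associator_cyclic a b p
  have h₂ := h.associator_cyclic b p a
  have h₃ := h.mul_mul_of_anticommute a hbp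
  have h₄ : a * p * b + p * a * b = 0 := by rw [← add_mul, hap, zero_mul]
  rw [h₂] at h₁
  simp only [associator] at h₁
  linear_combination (norm := abel) habp - h₁ + h₃ - h₄

theorem anticommute_mul (h : IsAlternativeRing R) {a b p : R} (hab : a * b + b * a = 0)
    (hap : a * p + p * a = 0) (hbp : b * p + p * b = 0) (habp : a * b * p + p * (a * b) = 0) :
    a * p * b + b * (a * p) = 0 := by
  have h₁ := h.mul_mul_of_anticommute a hbp
  have h₂ : b * a = -(a * b) := by linear_combination (norm := abel) hab
  have h₃ := h.mul_mul_of_anticommute' hbp hap (by rw [h₂, neg_mul, mul_neg, ← neg_add, habp,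
      neg_zero])
  rw [h₃, h₂, neg_mul, neg_neg, h₁]
  abel

theorem anticommute_self_mul (h : IsAlternativeRing R) {a p : R} (hap : a * p + p * a = 0) :
    a * p * a + a * (a * p) = 0 := by
  have h₁ := h.associator_flexible a p
  rw [associator, sub_eq_zero] at h₁
  rw [h₁, ← mul_add, add_comm, hap, mul_zero]

theorem anticommute_mul_self (h : IsAlternativeRing R) {a p : R} (hap : a * p + p * a = 0) :
    a * p * p + p * (a * p) = 0 := by
  have h₁ := h.associator_flexible p a
  rw [associator, sub_eq_zero] at h₁
  rw [← h₁, ← add_mul, hap, zero_mul]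

/-- If `w` anticommutes with the seven imaginary units generated by `i`, `j` and `l`, then
`2 (i (j (l w))) = 0`. -/
theorem two_mul_eq_zero_of_anticommute (h : IsAlternativeRing R) {i j l w : R}
    (hil : i * l + l * i = 0) (hjl : j * l + l * j = 0)
    (hkl : i * j * l + l * (i * j) = 0)
    (hiw : i * w + w * i = 0) (hjw : j * w + w * j = 0) (hkw : i * j * w + w * (i * j) = 0)
    (hlw : l * w + w * l = 0) (hilw : i * l * w + w * (i * l) = 0)
    (hjlw : j * l * w + w * (j * l) = 0) (hklw : i * j * l * w + w * (i * j * l) = 0) :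
    i * (j * (l * w)) + i * (j * (l * w)) = 0 := by
  have swap : ∀ {a b : R}, a * b + b * a = 0 → b * a = -(a * b) := fun hab => by
    linear_combination (norm := abel) hab
  have h₁ : i * j * l * w = -(i * j * (l * w)) := by
    rw [h.mul_mul_of_anticommute' hkw hlw hklw, neg_neg]
  have anti : ∀ {a : R}, a * l + l * a = 0 → a * w + w * a = 0 → a * l * w + w * (a * l) = 0 →
      a * (l * w) + l * w * a = 0 := by
    intro a hal haw halw
    rw [add_comm]
    refine h.anticommute_mul (by rw [add_comm, hal]) hlw haw ?_
    rw [swap hal, neg_mul, mul_neg, ← neg_add, halw, neg_zero]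
  have h₂ : i * j * (l * w) = -(i * (j * (l * w))) := by
    rw [h.mul_mul_of_anticommute' (anti hil hiw hilw) (anti hjl hjw hjlw) (anti hkl hkw hklw),
      neg_neg]
  have h₃ : i * (j * l) = -(i * j * l) := h.mul_mul_of_anticommute' hil hjl hkl
  have h₄ : i * (j * l * w) = -(i * (j * l) * w) :=
    h.mul_mul_of_anticommute' hiw hjlw (by rw [h₃, neg_mul, mul_neg, ← neg_add, hklw, neg_zero])
  have h₅ : j * (l * w) = -(j * l * w) := h.mul_mul_of_anticommute' hjw hlw hjlw
  rw [h₃, neg_mul, neg_neg, h₁, h₂, neg_neg] at h₄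
  -- Rebracketing has given i((jl)w) = i(j(lw)), while `h₅` gives the opposite sign. Rewriting one
  -- of the two copies therefore cancels the other.
  nth_rw 1 [h₅]
  rw [mul_neg, h₄, neg_add_cancel]

end IsAlternativeRing

/-! ### The norm form and its multiplicativity. -/

namespace IsQuadraticAlternative

variable {F A : Type*} [Field F] [NonAssocRing A] [Module F A]
variable [IsScalarTower F A A] [SMulCommClass F A A]

/-- The symmetric bilinear form attached to a linear form on a quadratic algebra. -/
def normForm (τ : A →ₗ[F] F) : LinearMap.BilinForm F A :=
  LinearMap.mk₂ F (fun x y => 2 * (τ x * τ y) - τ (x * y))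
    (fun x x' y => by simp only [map_add, add_mul]; ring)
    (fun c x y => by simp only [map_smul, smul_mul_assoc, smul_eq_mul]; ring)
    (fun x y y' => by simp only [map_add, mul_add]; ring)
    (fun c x y => by simp only [map_smul, mul_smul_comm, smul_eq_mul]; ring)

theorem normForm_apply (τ : A →ₗ[F] F) (x y : A) :
    normForm τ x y = 2 * (τ x * τ y) - τ (x * y) := rfl

theorem isImaginary_commutator (h : IsQuadraticAlternative F A) (x y : A) :
    IsImaginary F (x * y - y * x) := by
  refine ⟨h.commutator_sq x y, fun hv => ?_⟩
  have h₁ := h.commutator_sq x (x * y)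
  have h₂ := h.commutator_sq x (y + x * y)
  have e : x * (y + x * y) - (y + x * y) * x = (x * y - y * x) + x * (x * y - y * x) := by
    rw [← h.isAlternativeRing.commutator_self_mul, mul_add, add_mul]; abel
  rw [e] at h₂
  rw [h.isAlternativeRing.commutator_self_mul] at h₁
  obtain ⟨c, hc⟩ := Submodule.mem_span_singleton.mp hv
  by_cases hx : x ∈ Submodule.span F {(1 : A)}
  · obtain ⟨s, rfl⟩ := Submodule.mem_span_singleton.mp hx
    simp
  -- For v = c scalar, (c + cx)² - (cx)² - c² = 2c²x; for non-scalar x this forces c = 0.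
  have h₃ : (2 * (c * c)) • x ∈ Submodule.span F {(1 : A)} := by
    have h1 := Submodule.smul_mem _ (c * c) (Submodule.mem_span_singleton_self (R := F) (1 : A))
    have := sub_mem h₂ (add_mem h₁ h1)
    convert this using 1
    rw [← hc]
    simp only [mul_add, add_mul, smul_mul_assoc, mul_smul_comm, one_mul, mul_one]
    module
  rw [← hc, mul_self_eq_zero.mp ((mul_eq_zero.mp
    ((mem_of_smul_mem h₃).resolve_right hx)).resolve_left h.two_ne_zero), zero_smul]

section Trace

variable {τ : A →ₗ[F] F} [Nontrivial A]

theorem trace_eq_zero_iff (h : IsQuadraticAlternative F A)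
    (hτ : ∀ x, IsImaginary F (x - τ x • 1)) (x : A) : τ x = 0 ↔ IsImaginary F x := by
  constructor
  · intro h0
    have := hτ x
    rwa [h0, zero_smul, sub_zero] at this
  · intro hx
    exact h.isImaginary_unique (hτ x) (by rwa [zero_smul, sub_zero])

theorem trace_one (h : IsQuadraticAlternative F A) (hτ : ∀ x, IsImaginary F (x - τ x • 1)) :
    τ 1 = 1 :=
  h.isImaginary_unique (hτ 1) (by simp [IsImaginary])

theorem sq_eq (h : IsQuadraticAlternative F A) (hτ : ∀ x, IsImaginary F (x - τ x • 1)) (x : A) :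
    x * x = (2 * τ x) • x - normForm τ x x • 1 := by
  obtain ⟨s, hs⟩ := Submodule.mem_span_singleton.mp (hτ x).1
  have h₁ : x * x = (2 * τ x) • x + (s - τ x * τ x) • 1 := by
    simp only [mul_sub, sub_mul, smul_mul_assoc, mul_smul_comm, one_mul, mul_one] at hs
    rw [sub_smul, hs]
    module
  have h₂ := congrArg τ h₁
  rw [map_add, map_smul, map_smul, h.trace_one hτ, smul_eq_mul, smul_eq_mul, mul_one] at h₂
  rw [normForm_apply, h₂]
  nth_rw 1 [h₁]
  module

theorem trace_mul_comm (h : IsQuadraticAlternative F A) (hτ : ∀ x, IsImaginary F (x - τ x • 1))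
    (x y : A) : τ (x * y) = τ (y * x) := by
  rw [← sub_eq_zero, ← map_sub, h.trace_eq_zero_iff hτ]
  exact h.isImaginary_commutator x y

theorem normForm_comm (h : IsQuadraticAlternative F A) (hτ : ∀ x, IsImaginary F (x - τ x • 1))
    (x y : A) : normForm τ x y = normForm τ y x := by
  rw [normForm_apply, normForm_apply, h.trace_mul_comm hτ x y, mul_comm (τ x)]

theorem mul_add_mul (h : IsQuadraticAlternative F A) (hτ : ∀ x, IsImaginary F (x - τ x • 1))
    (x y : A) :
    x * y + y * x = (2 * τ y) • x + (2 * τ x) • y - (2 * normForm τ x y) • 1 := by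
  have h₁ := h.sq_eq hτ (x + y)
  have h₂ := h.sq_eq hτ x
  have h₃ := h.sq_eq hτ y
  have h₄ := h.normForm_comm hτ x y
  simp only [map_add, LinearMap.add_apply, mul_add, add_mul, ← h₄, h₂, h₃] at h₁
  have h₅ : x * y + y * x = (((2 * τ x) • x - normForm τ x x • (1 : A)) + y * x
      + (x * y + ((2 * τ y) • y - normForm τ y y • 1)))
      - ((2 * τ x) • x - normForm τ x x • 1) - ((2 * τ y) • y - normForm τ y y • 1) := by abel
  rw [h₅, h₁]
  module

/-- Expand (xy)(yx) = (xy²)x in two ways, using the quadratic equations of x, y and xy and the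
polarized formula for yx. -/
theorem normForm_mul (h : IsQuadraticAlternative F A) (hτ : ∀ x, IsImaginary F (x - τ x • 1))
    (x y : A) : normForm τ (x * y) (x * y) = normForm τ x x * normForm τ y y := by
  have hc := h.mul_add_mul hτ x y
  have hx := h.sq_eq hτ x
  have hy := h.sq_eq hτ y
  have hxy := h.sq_eq hτ (x * y)
  have a₁ : x * y * y = x * (y * y) := sub_eq_zero.mp (h.isAlternativeRing.associator_self_right y
      x)
  have a₂ : x * y * (y * x) = x * y * y * x := by
    have := h.isAlternativeRing.associator_mul_right_self x y
    have h' : associator (x * y) y x = 0 := by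
      rw [h.isAlternativeRing.associator_swap_right, this, neg_zero]
    exact (sub_eq_zero.mp h').symm
  have hyx : y * x = (2 * τ y) • x + (2 * τ x) • y - (2 * normForm τ x y) • 1 - x * y := by
    rw [← hc]; abel
  have a₃ := a₂
  rw [a₁, hy, hyx] at a₃
  simp only [mul_sub, mul_add, sub_mul, mul_smul_comm, smul_mul_assoc, mul_one, a₁, hy, hxy, hx]
    at a₃
  have h₁ : normForm τ (x * y) (x * y) • (1 : A) = (normForm τ x x * normForm τ y y) • 1 := by
    have h₂ : 2 * τ (x * y) = 4 * (τ x * τ y) - 2 * normForm τ x y := by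
      rw [normForm_apply]; ring
    rw [h₂] at a₃
    linear_combination (norm := module) a₃
  have h₂ := congrArg τ h₁
  rwa [map_smul, map_smul, h.trace_one hτ, smul_eq_mul, smul_eq_mul, mul_one, mul_one] at h₂

theorem normForm_self_ne_zero (h : IsQuadraticAlternative F A)
    (hτ : ∀ x, IsImaginary F (x - τ x • 1)) {x : A} (hx : x ≠ 0) : normForm τ x x ≠ 0 := by
  intro h0
  have h₁ := h.sq_eq hτ x
  rw [h0, zero_smul, sub_zero] at h₁
  have h₂ : x * (x - (2 * τ x) • 1) = 0 := by
    rw [mul_sub, h₁, mul_smul_comm, mul_one, sub_self]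
  have h₃ := sub_eq_zero.mp ((h.eq_zero_or_eq_zero _ _ h₂).resolve_left hx)
  have h₄ := congrArg τ h₃
  rw [map_smul, h.trace_one hτ, smul_eq_mul, mul_one] at h₄
  have h₅ : τ x = 0 := by linear_combination -h₄
  rw [h₅, mul_zero, zero_smul] at h₃
  exact hx h₃

theorem anticommute_of_normForm_eq_zero (h : IsQuadraticAlternative F A)
    (hτ : ∀ x, IsImaginary F (x - τ x • 1)) {x y : A} (hx : normForm τ 1 x = 0)
    (hy : normForm τ 1 y = 0) (hxy : normForm τ x y = 0) : x * y + y * x = 0 := by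
  rw [normForm_apply, h.trace_one hτ, one_mul, one_mul] at hx hy
  have hx' : τ x = 0 := by linear_combination hx
  have hy' : τ y = 0 := by linear_combination hy
  rw [h.mul_add_mul hτ, hx', hy', hxy]
  simp

end Trace

end IsQuadraticAlternative

/-! ### Orthogonal families for a symmetric bilinear form. -/

section Orthogonal

variable {F V : Type*} [Field F] [AddCommGroup V] [Module F V] {B : LinearMap.BilinForm F V}

theorem exists_orthogonal_sub {L : List V} (hL : L.Pairwise fun x y => B x y = 0)
    (hB : ∀ x y, B x y = B y x) (hne : ∀ x ∈ L, B x x ≠ 0) (v : V) :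
    ∃ w ∈ Submodule.span F {x | x ∈ L}, ∀ x ∈ L, B x (v - w) = 0 := by
  induction L with
  | nil => exact ⟨0, zero_mem _, by simp⟩
  | cons a L ih =>
    rw [List.pairwise_cons] at hL
    obtain ⟨w, hw, hwL⟩ := ih hL.2 fun x hx => hne x (List.mem_cons_of_mem _ hx)
    have haa := hne a List.mem_cons_self
    have haw : B a w = 0 := by
      clear hwL
      induction hw using Submodule.span_induction with
      | mem x hx => exact hL.1 x hx
      | zero => simp
      | add x y _ _ hx hy => rw [map_add, hx, hy, add_zero]
      | smul c x _ hx => rw [map_smul, hx, smul_zero]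
    refine ⟨w + (B a v / B a a) • a, add_mem ?_ (Submodule.smul_mem _ _
      (Submodule.subset_span List.mem_cons_self)), fun x hx => ?_⟩
    · exact Submodule.span_mono (fun x hx => List.mem_cons_of_mem _ hx) hw
    · rw [← sub_sub, map_sub, map_smul, smul_eq_mul]
      rcases List.mem_cons.mp hx with rfl | hx
      · rw [map_sub, haw]
        field_simp
        ring
      · rw [hwL x hx, hB x a, hL.1 x hx, mul_zero, sub_zero]

theorem finrank_eq_length_of_orthogonal {L : List V} (hL : L.Pairwise fun x y => B x y = 0)
    (hB : ∀ x y, B x y = B y x) (hne : ∀ x ∈ L, B x x ≠ 0)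
    (htop : ∀ w, (∀ x ∈ L, B x w = 0) → w = 0) : Module.finrank F V = L.length := by
  have hli : LinearIndependent F (fun a : Fin L.length => L.get a) := by
    refine LinearMap.BilinForm.linearIndependent_of_iIsOrtho (B := B) ?_ ?_
    · intro a b hab
      rw [List.pairwise_iff_get] at hL
      rcases lt_or_gt_of_ne hab with h | h
      · exact hL a b h
      · exact (hB _ _).trans (hL b a h)
    · intro a
      exact hne _ (List.get_mem L a)
  have hspan : ⊤ ≤ Submodule.span F (Set.range fun a : Fin L.length => L.get a) := by
    intro v _
    obtain ⟨w, hw, hwL⟩ := exists_orthogonal_sub hL hB hne v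
    rw [sub_eq_zero.mp (htop _ hwL)]
    convert hw
    ext x
    simp [List.mem_iff_get]
  rw [Module.finrank_eq_card_basis (Module.Basis.mk hli hspan), Fintype.card_fin]

end Orthogonal

/-! ### Dimension eight, the octonion structure and division. -/

namespace IsQuadraticAlternative

variable {F A : Type*} [Field F] [NonAssocRing A] [Module F A]

theorem associator_one_left (x y : A) : associator (1 : A) x y = 0 := by simp [associator]

variable [IsScalarTower F A A]

theorem associator_smul_left (c : F) (x y z : A) :
    associator (c • x) y z = c • associator x y z := by
  simp only [associator, smul_mul_assoc, smul_sub]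

theorem associator_eq_zero_of_mem_span {S : Set A} {p q w : A}
    (hS : ∀ x ∈ S, associator x p q = 0) (hw : w ∈ Submodule.span F S) : associator w p q = 0 := by
  induction hw using Submodule.span_induction with
  | mem x hx => exact hS x hx
  | zero => simp [associator]
  | add x y _ _ hx hy => rw [associator_add_left, hx, hy, add_zero]
  | smul c x _ hx => rw [associator_smul_left, hx, smul_zero]

variable [SMulCommClass F A A] {τ : A →ₗ[F] F} [Nontrivial A]

theorem normForm_one_left (h : IsQuadraticAlternative F A)
    (hτ : ∀ x, IsImaginary F (x - τ x • 1)) (x : A) : normForm τ 1 x = τ x := by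
  rw [normForm_apply, h.trace_one hτ, one_mul, one_mul]
  ring

theorem normForm_one_mul (h : IsQuadraticAlternative F A)
    (hτ : ∀ x, IsImaginary F (x - τ x • 1)) {x y : A} (hx : normForm τ 1 x = 0)
    (hxy : normForm τ x y = 0) : normForm τ 1 (x * y) = 0 := by
  rw [h.normForm_one_left hτ] at hx ⊢
  rw [normForm_apply, hx] at hxy
  linear_combination -hxy

theorem normForm_eq_zero_of_anticommute (h : IsQuadraticAlternative F A)
    (hτ : ∀ x, IsImaginary F (x - τ x • 1)) {x y : A} (hx : normForm τ 1 x = 0)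
    (hy : normForm τ 1 y = 0) (hxy : x * y + y * x = 0) : normForm τ x y = 0 := by
  rw [h.normForm_one_left hτ] at hx hy
  rw [h.mul_add_mul hτ, hx, hy, mul_zero, zero_smul, zero_smul, add_zero, zero_sub,
    neg_eq_zero] at hxy
  exact (mul_eq_zero.mp ((smul_eq_zero.mp hxy).resolve_right one_ne_zero)).resolve_left
    h.two_ne_zero

theorem normForm_mul_right (h : IsQuadraticAlternative F A)
    (hτ : ∀ x, IsImaginary F (x - τ x • 1)) (x y z : A) :
    normForm τ (x * z) (y * z) = normForm τ x y * normForm τ z z := by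
  have h₁ := h.normForm_mul hτ (x + y) z
  have h₂ := h.normForm_mul hτ x z
  have h₃ := h.normForm_mul hτ y z
  simp only [add_mul, map_add, LinearMap.add_apply, h.normForm_comm hτ y x,
    h.normForm_comm hτ (y * z) (x * z)] at h₁
  have h₄ : 2 * (normForm τ (x * z) (y * z) - normForm τ x y * normForm τ z z) = 0 := by
    linear_combination h₁ - h₂ - h₃
  exact sub_eq_zero.mp ((mul_eq_zero.mp h₄).resolve_left h.two_ne_zero)

/-- A non-associative quadratic alternative algebra contains mutually orthogonal generators of an
octonion algebra. -/
theorem exists_orthogonal_triple (h : IsQuadraticAlternative F A)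
    (hτ : ∀ x, IsImaginary F (x - τ x • 1)) (hna : ∃ x y z : A, associator x y z ≠ 0) :
    ∃ i j l : A, i ≠ 0 ∧ j ≠ 0 ∧ l ≠ 0 ∧ normForm τ 1 i = 0 ∧ normForm τ 1 j = 0 ∧
      normForm τ i j = 0 ∧ ∀ x ∈ [1, i, j, i * j], normForm τ x l = 0 := by
  have ha := h.isAlternativeRing
  have hB := h.normForm_comm hτ
  have hne : ∀ x : A, x ≠ 0 → normForm τ x x ≠ 0 := fun x => h.normForm_self_ne_zero hτ
  obtain ⟨x, y, z, hxyz⟩ := hna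
  obtain ⟨w, hw, hi⟩ := exists_orthogonal_sub (B := normForm τ) (L := [1]) (by simp) hB
    (by simpa using hne 1 one_ne_zero) x
  -- Each projection subtracted lies in a span on which the relevant associator vanishes, so the
  -- associator stays non-zero, and with it the new vector.
  have hi1 : associator (x - w) y z ≠ 0 := by
    rwa [associator_sub_left, associator_eq_zero_of_mem_span (F := F) _ hw, sub_zero]
    simp [associator]
  generalize x - w = i at *
  have hi0 : i ≠ 0 := by rintro rfl; simp [associator] at hi1
  replace hi : normForm τ 1 i = 0 := hi 1 (by simp)
  rw [ha.associator_swap_left, neg_ne_zero] at hi1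
  obtain ⟨w, hw, hj⟩ := exists_orthogonal_sub (B := normForm τ) (L := [1, i]) (by simpa using hi) hB
    (by simpa using ⟨hne 1 one_ne_zero, hne i hi0⟩) y
  have hj1 : associator (y - w) i z ≠ 0 := by
    rwa [associator_sub_left, associator_eq_zero_of_mem_span (F := F) _ hw, sub_zero]
    simp [associator_one_left, ha.associator_self_left]
  generalize y - w = j at *
  have hj0 : j ≠ 0 := by rintro rfl; simp [associator] at hj1
  have h1j : normForm τ 1 j = 0 := hj 1 (by simp)
  have hij : normForm τ i j = 0 := hj i (by simp)
  have hk0 : i * j ≠ 0 := fun h0 => (h.eq_zero_or_eq_zero _ _ h0).elim hi0 hj0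
  have hanti := h.anticommute_of_normForm_eq_zero hτ hi h1j hij
  have h1k : normForm τ 1 (i * j) = 0 := h.normForm_one_mul hτ hi hij
  have hik : normForm τ i (i * j) = 0 :=
    h.normForm_eq_zero_of_anticommute hτ hi h1k (by
      rw [add_comm]; exact ha.anticommute_self_mul hanti)
  have hjk : normForm τ j (i * j) = 0 :=
    h.normForm_eq_zero_of_anticommute hτ h1j h1k (by
      rw [add_comm]; exact ha.anticommute_mul_self hanti)
  rw [← ha.associator_cyclic] at hj1
  obtain ⟨w, hw, hl⟩ := exists_orthogonal_sub (B := normForm τ) (L := [1, i, j, i * j])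
    (by simp [hi, h1j, h1k, hij, hik, hjk]) hB
    (by simpa using ⟨hne 1 one_ne_zero, hne i hi0, hne j hj0, hne _ hk0⟩) z
  have hl1 : associator (z - w) j i ≠ 0 := by
    rwa [associator_sub_left, associator_eq_zero_of_mem_span (F := F) _ hw, sub_zero]
    have e₁ : associator i j i = 0 := ha.associator_flexible i j
    have e₂ : associator (i * j) j i = 0 := by
      rw [ha.associator_swap_right, ha.associator_mul_right_self, neg_zero]
    simp [associator_one_left, ha.associator_self_left, e₁, e₂]
  refine ⟨i, j, z - w, hi0, hj0, ?_, hi, h1j, hij, hl⟩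
  intro h0
  simp [h0, associator] at hl1

theorem finrank_eq_eight (h : IsQuadraticAlternative F A)
    (hτ : ∀ x, IsImaginary F (x - τ x • 1)) (hna : ∃ x y z : A, associator x y z ≠ 0) :
    Module.finrank F A = 8 := by
  have ha := h.isAlternativeRing
  have hB := h.normForm_comm hτ
  have hne : ∀ x : A, x ≠ 0 → normForm τ x x ≠ 0 := fun x => h.normForm_self_ne_zero hτ
  have h0 : ∀ {x y : A}, x ≠ 0 → y ≠ 0 → x * y ≠ 0 := fun hx hy hxy =>
    (h.eq_zero_or_eq_zero _ _ hxy).elim hx hy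
  obtain ⟨i, j, l, hi0, hj0, hl0, h1i, h1j, hij, hl⟩ := h.exists_orthogonal_triple hτ hna
  simp only [List.forall_mem_cons, List.not_mem_nil, false_imp_iff, implies_true, and_true] at hl
  obtain ⟨h1l, hil, hjl, hkl⟩ := hl
  have anti : ∀ {x y : A}, normForm τ 1 x = 0 → normForm τ 1 y = 0 → normForm τ x y = 0 →
      x * y + y * x = 0 := fun hx hy hxy => h.anticommute_of_normForm_eq_zero hτ hx hy hxy
  have orth : ∀ {x y : A}, normForm τ 1 x = 0 → normForm τ 1 y = 0 → x * y + y * x = 0 →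
      normForm τ y x = 0 := fun hx hy hxy =>
    h.normForm_eq_zero_of_anticommute hτ hy hx (by rw [add_comm, hxy])
  have h1k := h.normForm_one_mul hτ h1i hij
  have h1il := h.normForm_one_mul hτ h1i hil
  have h1jl := h.normForm_one_mul hτ h1j hjl
  have h1kl := h.normForm_one_mul hτ h1k hkl
  have Pij := anti h1i h1j hij
  have hik := orth h1k h1i (ha.anticommute_self_mul Pij)
  have hjk := orth h1k h1j (ha.anticommute_mul_self Pij)
  have Pik := anti h1i h1k hik
  have Pjk := anti h1j h1k hjk
  have Pil := anti h1i h1l hil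
  have Pjl := anti h1j h1l hjl
  have Pkl := anti h1k h1l hkl
  have sq : ∀ {x : A}, normForm τ 1 x = 0 → x * x = (-normForm τ x x) • 1 := by
    intro x hx
    rw [h.normForm_one_left hτ] at hx
    rw [h.sq_eq hτ, hx, mul_zero, zero_smul, zero_sub, neg_smul]
  have Psmul : ∀ {x : A} (c : F), x * l + l * x = 0 → (c • x) * l + l * (c • x) = 0 := by
    intro x c hx
    rw [smul_mul_assoc, mul_smul_comm, ← smul_add, hx, smul_zero]
  have Pswap : ∀ {x y : A}, x * y + y * x = 0 → x * y * l + l * (x * y) = 0 →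
      y * x * l + l * (y * x) = 0 := by
    intro x y hxy hl
    have : y * x = -(x * y) := by linear_combination (norm := abel) hxy
    rw [this, neg_mul, mul_neg, ← neg_add, hl, neg_zero]
  have Pikl : i * (i * j) * l + l * (i * (i * j)) = 0 := by
    rw [← sub_eq_zero.mp (ha.associator_self_left i j), sq h1i, smul_mul_assoc, one_mul]
    exact Psmul _ Pjl
  have Pkjl : i * j * j * l + l * (i * j * j) = 0 := by
    rw [sub_eq_zero.mp (ha.associator_self_right j i), sq h1j, mul_smul_comm, mul_one]
    exact Psmul _ Pil
  have comm : ∀ {x y : A}, x * y + y * x = 0 → y * x + x * y = 0 := fun hxy => by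
    rw [add_comm, hxy]
  have hL : [1, i, j, i * j, l, i * l, j * l, i * j * l].Pairwise
      fun x y => normForm τ x y = 0 := by
    simp only [List.pairwise_cons, List.forall_mem_cons, List.not_mem_nil, false_imp_iff,
      implies_true, and_true, List.Pairwise.nil]
    refine ⟨⟨h1i, h1j, h1k, h1l, h1il, h1jl, h1kl⟩, ⟨hij, hik, hil, ?_, ?_, ?_⟩,
      ⟨hjk, hjl, ?_, ?_, ?_⟩, ⟨hkl, ?_, ?_, ?_⟩, ⟨?_, ?_, ?_⟩, ⟨?_, ?_⟩, ?_⟩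
    · exact orth h1il h1i (ha.anticommute_self_mul Pil)
    · exact orth h1jl h1i (ha.anticommute_mul (comm Pij) Pjl Pil (Pswap Pij Pkl))
    · exact orth h1kl h1i (ha.anticommute_mul (comm Pik) Pkl Pil (Pswap Pik Pikl))
    · exact orth h1il h1j (ha.anticommute_mul Pij Pil Pjl Pkl)
    · exact orth h1jl h1j (ha.anticommute_self_mul Pjl)
    · exact orth h1kl h1j (ha.anticommute_mul (comm Pjk) Pkl Pjl Pkjl)
    · exact orth h1il h1k (ha.anticommute_mul Pik Pil Pkl Pikl)
    · exact orth h1jl h1k (ha.anticommute_mul Pjk Pjl Pkl (Pswap (comm Pjk) Pkjl))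
    · exact orth h1kl h1k (ha.anticommute_self_mul Pkl)
    · exact orth h1il h1l (ha.anticommute_mul_self Pil)
    · exact orth h1jl h1l (ha.anticommute_mul_self Pjl)
    · exact orth h1kl h1l (ha.anticommute_mul_self Pkl)
    · rw [h.normForm_mul_right hτ, hij, zero_mul]
    · rw [h.normForm_mul_right hτ, hik, zero_mul]
    · rw [h.normForm_mul_right hτ, hjk, zero_mul]
  refine finrank_eq_length_of_orthogonal hL hB ?_ ?_
  · simp only [List.forall_mem_cons, List.not_mem_nil, false_imp_iff, implies_true, and_true]
    exact ⟨hne _ one_ne_zero, hne _ hi0, hne _ hj0, hne _ (h0 hi0 hj0), hne _ hl0,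
      hne _ (h0 hi0 hl0), hne _ (h0 hj0 hl0), hne _ (h0 (h0 hi0 hj0) hl0)⟩
  -- A vector orthogonal to all eight anticommutes with the seven imaginary ones.
  · intro w hw
    simp only [List.forall_mem_cons, List.not_mem_nil, false_imp_iff, implies_true,
      and_true] at hw
    obtain ⟨h1w, hiw, hjw, hkw, hlw, hilw, hjlw, hklw⟩ := hw
    have h₁ := ha.two_mul_eq_zero_of_anticommute Pil Pjl Pkl (anti h1i h1w hiw)
      (anti h1j h1w hjw) (anti h1k h1w hkw) (anti h1l h1w hlw) (anti h1il h1w hilw)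
      (anti h1jl h1w hjlw) (anti h1kl h1w hklw)
    rw [← two_smul F] at h₁
    by_contra hw0
    exact h0 hi0 (h0 hj0 (h0 hl0 hw0)) ((smul_eq_zero.mp h₁).resolve_left h.two_ne_zero)

theorem isOctonionAlgebra (h : IsQuadraticAlternative F A)
    (hna : ∃ x y z : A, associator x y z ≠ 0) : IsOctonionAlgebra F A where
  isField := Field.toIsField F
  smul_mul := smul_mul_assoc
  mul_smul t a b := mul_smul_comm t a b
  finrank_eq := by
    obtain ⟨τ, hτ⟩ := h.exists_trace
    exact h.finrank_eq_eight hτ hna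
  exists_norm := by
    obtain ⟨τ, hτ⟩ := h.exists_trace
    -- The polar form at (x, x) is twice the anisotropic norm, so it is nondegenerate.
    have key : ∀ x, QuadraticMap.polarBilin (normForm τ).toQuadraticMap x x = 0 → x = 0 := by
      intro x hx
      by_contra hx0
      have h₁ : 2 * normForm τ x x = 0 := by
        simp only [QuadraticMap.polarBilin_apply_apply, QuadraticMap.polar,
          LinearMap.BilinMap.toQuadraticMap_apply, map_add, LinearMap.add_apply] at hx
        linear_combination hx
      exact h.normForm_self_ne_zero hτ hx0 ((mul_eq_zero.mp h₁).resolve_left h.two_ne_zero)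
    refine ⟨(normForm τ).toQuadraticMap, fun a b => h.normForm_mul hτ a b, ?_, ?_⟩
    · exact fun x hx => key x (hx x)
    · exact fun x hx => key x (hx x)

/-- The inverse of a is its conjugate 2τ(a) - a divided by its norm. -/
theorem isNonAssocDivisionRing (h : IsQuadraticAlternative F A) : IsNonAssocDivisionRing A := by
  refine ⟨inferInstance, fun a b ha => ?_⟩
  obtain ⟨τ, hτ⟩ := h.exists_trace
  have hN := h.normForm_self_ne_zero hτ ha
  have hsq := h.sq_eq hτ a
  have h₁ : a * (a * b) = (2 * τ a) • (a * b) - normForm τ a a • b := by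
    rw [← sub_eq_zero.mp (h.isAlternativeRing.associator_self_left a b), hsq, sub_mul,
      smul_mul_assoc,
      smul_mul_assoc, one_mul]
  have h₂ : b * a * a = (2 * τ a) • (b * a) - normForm τ a a • b := by
    rw [sub_eq_zero.mp (h.isAlternativeRing.associator_self_right a b), hsq, mul_sub, mul_smul_comm,
      mul_smul_comm, mul_one]
  refine ⟨existsUnique_of_exists_of_unique
      ⟨(normForm τ a a)⁻¹ • ((2 * τ a) • b - a * b), ?_⟩ fun y z hy hz => ?_,
    existsUnique_of_exists_of_unique
      ⟨(normForm τ a a)⁻¹ • ((2 * τ a) • b - b * a), ?_⟩ fun y z hy hz => ?_⟩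
  · simp only [mul_smul_comm, mul_sub, h₁]
    rw [sub_sub_cancel, smul_smul, inv_mul_cancel₀ hN, one_smul]
  · have h₃ : a * (y - z) = 0 := by rw [mul_sub, hy, hz, sub_self]
    exact sub_eq_zero.mp ((h.eq_zero_or_eq_zero _ _ h₃).resolve_left ha)
  · simp only [smul_mul_assoc, sub_mul, h₂]
    rw [sub_sub_cancel, smul_smul, inv_mul_cancel₀ hN, one_smul]
  · have h₃ : (y - z) * a = 0 := by rw [sub_mul, hy, hz, sub_self]
    exact sub_eq_zero.mp ((h.eq_zero_or_eq_zero _ _ h₃).resolve_right ha)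

end IsQuadraticAlternative

/-! ### Passage to the central quotient. -/

namespace CentralQuotient

variable {R : Type*} [NonUnitalNonAssocRing R] [NoZeroDivisors R]

theorem Denom.mul_comm (c d : Denom R) : c * d = d * c :=
  Subtype.ext (Subtype.ext (Denom.comm d c.val))

theorem Denom.mul_assoc (c d e : Denom R) : c * d * e = c * (d * e) :=
  Subtype.ext (Subtype.ext (Denom.assoc c d.val e.val))

theorem mk_add_same (r s : R) (c : Denom R) : mk r c + mk s c = mk (r + s) c := by
  rw [mk_add, mk_eq_mk, Denom.mul_apply, ← mul_add]

variable [Nontrivial (NonUnitalSubring.center R)]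

theorem mk_eq_zero {r : R} {c : Denom R} : mk r c = 0 ↔ r = 0 := by
  rw [zero_eq c, mk_eq_mk, mul_zero, mul_eq_zero, or_iff_right c.val_ne_zero]

theorem mk_sub_same (r s : R) (c : Denom R) : mk r c - mk s c = mk (r - s) c := by
  rw [sub_eq_add_neg, mk_neg, mk_add_same, sub_eq_add_neg]

theorem associator_mk (r s t : R) (c d e : Denom R) :
    associator (mk r c) (mk s d) (mk t e) = mk (associator r s t) (c * d * e) := by
  rw [associator_apply, mk_mul, mk_mul, mk_mul, mk_mul, ← Denom.mul_assoc, mk_sub_same,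
    associator_apply]

theorem commutator_mk (r s : R) (c d : Denom R) :
    mk r c * mk s d - mk s d * mk r c = mk (r * s - s * r) (c * d) := by
  rw [mk_mul, mk_mul, Denom.mul_comm d c, mk_sub_same]

theorem isAlternativeRing (h : IsAlternativeRing R) : IsAlternativeRing (CentralQuotient R) := by
  intro x y
  obtain ⟨r, c, rfl⟩ := mk_surj x
  obtain ⟨s, d, rfl⟩ := mk_surj y
  rw [associator_mk, associator_mk, h.associator_self_left, h.associator_self_right, mk_eq_zero,
    mk_eq_zero]
  exact ⟨rfl, rfl⟩

theorem exists_associator_ne_zero (hna : ∃ x y z : R, associator x y z ≠ 0) :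
    ∃ x y z : CentralQuotient R, associator x y z ≠ 0 := by
  obtain ⟨x, y, z, h⟩ := hna
  have c : Denom R := Classical.arbitrary _
  exact ⟨mk x c, mk y c, mk z c, by rwa [associator_mk, Ne, mk_eq_zero]⟩

theorem mul_eq_zero_iff {x y : CentralQuotient R} : x * y = 0 ↔ x = 0 ∨ y = 0 := by
  obtain ⟨r, c, rfl⟩ := mk_surj x
  obtain ⟨s, d, rfl⟩ := mk_surj y
  rw [mk_mul, mk_eq_zero, mk_eq_zero, mk_eq_zero, mul_eq_zero]

theorem mk_mem_center {r : R} (hr : r ∈ NonUnitalSubring.center R) (c : Denom R) :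
    mk r c ∈ Subring.center (CentralQuotient R) := by
  refine ⟨fun a => ?_, fun a b => ?_, fun a b => ?_⟩
  · obtain ⟨a, x, rfl⟩ := mk_surj a
    change mk r c * mk a x = mk a x * mk r c
    rw [mk_mul, mk_mul, Denom.mul_comm, hr.comm]
  · obtain ⟨a, x, rfl⟩ := mk_surj a
    obtain ⟨b, y, rfl⟩ := mk_surj b
    rw [mk_mul, mk_mul, mk_mul, mk_mul, Denom.mul_assoc, hr.left_assoc]
  · obtain ⟨a, x, rfl⟩ := mk_surj a
    obtain ⟨b, y, rfl⟩ := mk_surj b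
    rw [mk_mul, mk_mul, mk_mul, mk_mul, Denom.mul_assoc, hr.right_assoc]

/-- A fraction vanishes only with its numerator. Hence a non-zero central r / c has the inverse c /
r. -/
theorem mem_center_of_mk_mem_center {r : R} {c : Denom R}
    (h : mk r c ∈ Subring.center (CentralQuotient R)) : r ∈ NonUnitalSubring.center R := by
  refine ⟨fun a => ?_, fun a b => ?_, fun a b => ?_⟩
  · have h₁ := (h.comm (mk a c)).eq
    rw [← sub_eq_zero, commutator_mk, mk_eq_zero] at h₁
    exact sub_eq_zero.mp h₁
  · have h₁ := h.left_assoc (mk a c) (mk b c)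
    have h₂ := associator_mk r a b c c c
    rw [associator_apply, ← h₁, sub_self, eq_comm, mk_eq_zero] at h₂
    exact (sub_eq_zero.mp h₂).symm
  · have h₁ := h.right_assoc (mk a c) (mk b c)
    have h₂ := associator_mk a b r c c c
    rw [associator_apply, ← h₁, sub_self, eq_comm, mk_eq_zero] at h₂
    exact sub_eq_zero.mp h₂

theorem isField_center : IsField (Subring.center (CentralQuotient R)) where
  exists_pair_ne := by
    refine ⟨0, 1, fun h => ?_⟩
    have c : Denom R := Classical.arbitrary _
    have h₁ : (0 : CentralQuotient R) = 1 := congrArg Subtype.val h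
    rw [one_eq c, eq_comm, mk_eq_zero] at h₁
    exact c.val_ne_zero h₁
  mul_comm := mul_comm
  mul_inv_cancel := by
    rintro ⟨q, hq⟩ hne
    obtain ⟨r, c, rfl⟩ := mk_surj q
    have hr := mem_center_of_mk_mem_center hq
    have hr0 : r ≠ 0 := fun h => hne (Subtype.ext (mk_eq_zero.mpr h))
    let d : Denom R := ⟨⟨r, hr⟩, fun h => hr0 (congrArg Subtype.val h)⟩
    refine ⟨⟨mk c.val d, mk_mem_center c.1.2 d⟩, Subtype.ext ?_⟩
    change mk r c * mk c.val d = 1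
    rw [mk_mul, one_eq (c * d), mk_eq_mk]
    congr 1
    exact hr.comm _

theorem isFractionFieldMap : IsFractionFieldMap (ofCenter R) where
  isField := isField_center
  injective a b h := by
    have c : Denom R := Classical.arbitrary _
    have h₁ : of R a = of R b := congrArg Subtype.val h
    rw [of_eq _ c, of_eq _ c, mk_eq_mk] at h₁
    exact Subtype.ext (c.cancel (c.cancel h₁))
  surj := by
    rintro ⟨q, hq⟩
    obtain ⟨r, c, rfl⟩ := mk_surj q
    refine ⟨⟨r, mem_center_of_mk_mem_center hq⟩, c.1, c.2, Subtype.ext ?_⟩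
    change mk r c * of R c.val = of R r
    rw [of_eq _ c, of_eq _ c, mk_mul, mk_eq_mk, Denom.mul_apply, Denom.left_comm c r, Denom.comm]

theorem commutator_sq_mem_center
    (hsq : ∀ x y : R, (x * y - y * x) * (x * y - y * x) ∈ NonUnitalSubring.center R)
    (x y : CentralQuotient R) :
    (x * y - y * x) * (x * y - y * x) ∈ Subring.center (CentralQuotient R) := by
  obtain ⟨r, c, rfl⟩ := mk_surj x
  obtain ⟨s, d, rfl⟩ := mk_surj y
  rw [commutator_mk, mk_mul]
  exact mk_mem_center (hsq r s) _

instance : IsScalarTower (Subring.center (CentralQuotient R)) (CentralQuotient R)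
    (CentralQuotient R) where
  smul_assoc z x y := (z.2.left_assoc x y).symm

instance : SMulCommClass (Subring.center (CentralQuotient R)) (CentralQuotient R)
    (CentralQuotient R) where
  smul_comm z x y := z.2.left_comm x y

theorem smul_def (z : Subring.center (CentralQuotient R)) (x : CentralQuotient R) :
    z • x = (z : CentralQuotient R) * x := rfl

theorem exists_monic_quadratic (h : IsAlternativeRing R)
    (hsq : ∀ x y : R, (x * y - y * x) * (x * y - y * x) ∈ NonUnitalSubring.center R)
    (hZ : ∀ x ∉ NonUnitalSubring.center R, ∃ y, x * y - y * x ≠ 0) (x : CentralQuotient R) :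
    ∃ t n : Subring.center (CentralQuotient R), x * x - t • x = n • 1 := by
  by_cases hx : x ∈ Subring.center (CentralQuotient R)
  · exact ⟨⟨x, hx⟩, 0, by rw [smul_def, sub_self, zero_smul]⟩
  · obtain ⟨y, hy⟩ : ∃ y, x * y - y * x ≠ 0 := by
      obtain ⟨r, c, rfl⟩ := mk_surj x
      obtain ⟨s, hs⟩ := hZ r fun hr => hx (mk_mem_center hr c)
      exact ⟨mk s c, by rwa [commutator_mk, Ne, mk_eq_zero]⟩
    have ha := isAlternativeRing h
    have hsq' := commutator_sq_mem_center hsq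
    have hreg : ∀ v : CentralQuotient R, ¬ IsLeftZeroDivisor v := by
      rintro v ⟨hv, w, hw, hvw⟩
      exact (mul_eq_zero_iff.mp hvw).elim hv hw
    obtain ⟨c, hc, m, hm, hc0, e⟩ :=
      ha.exists_quadratic (fun v w _ => Or.inl (hreg _)) hsq' hy
    rw [← ha.commutator_self_mul] at e
    -- Division by the leading coefficient makes the equation monic.
    obtain ⟨⟨b, hb⟩, hcb⟩ := isField_center.mul_inv_cancel (a := ⟨c, hc⟩)
      fun h0 => hc0 (congrArg Subtype.val h0)
    have hbc : b * c = 1 := (hb.comm c).eq.trans (congrArg Subtype.val hcb)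
    refine ⟨⟨b * m, mul_mem hb hm⟩, ⟨-(b * _), neg_mem (mul_mem hb (hsq' x (x * y)))⟩, ?_⟩
    rw [smul_def, smul_def, mul_one]
    change x * x - b * m * x = -(b * _)
    rw [← hb.left_assoc, ← one_mul (x * x), ← hbc, ← hb.left_assoc, e, mul_sub]
    abel

theorem two_ne_zero_center (hR : ∃ r : R, r + r ≠ 0) :
    (2 : Subring.center (CentralQuotient R)) ≠ 0 := by
  obtain ⟨r, hr⟩ := hR
  intro h
  have c : Denom R := Classical.arbitrary _
  have h₁ : (2 : Subring.center (CentralQuotient R)) • mk r c = 0 := by rw [h, zero_smul]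
  rw [two_smul, mk_add_same, mk_eq_zero] at h₁
  exact hr h₁

theorem isOctonionAlgebra_and_isNonAssocDivisionRing (h : IsAlternativeRing R)
    (hna : ∃ x y z : R, associator x y z ≠ 0)
    (hsq : ∀ x y : R, (x * y - y * x) * (x * y - y * x) ∈ NonUnitalSubring.center R)
    (hZ : ∀ x ∉ NonUnitalSubring.center R, ∃ y, x * y - y * x ≠ 0)
    (hR : ∃ r : R, r + r ≠ 0) :
    IsOctonionAlgebra (Subring.center (CentralQuotient R)) (CentralQuotient R) ∧
      IsNonAssocDivisionRing (CentralQuotient R) := by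
  have : Nontrivial (CentralQuotient R) := by
    obtain ⟨x, y, z, hx⟩ := exists_associator_ne_zero hna
    exact ⟨_, _, hx⟩
  let _ : Field (Subring.center (CentralQuotient R)) := isField_center.toField
  have hq : IsQuadraticAlternative (Subring.center (CentralQuotient R)) (CentralQuotient R) :=
    { isAlternativeRing := isAlternativeRing h
      two_ne_zero := two_ne_zero_center hR
      eq_zero_or_eq_zero := fun a b hab => mul_eq_zero_iff.mp hab
      exists_quadratic := fun x => by
        obtain ⟨t, n, e⟩ := exists_monic_quadratic h hsq hZ x
        exact ⟨t, Submodule.mem_span_singleton.mpr ⟨n, e.symm⟩⟩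
      commutator_sq := fun x y => Submodule.mem_span_singleton.mpr
        ⟨⟨_, commutator_sq_mem_center hsq x y⟩, mul_one _⟩ }
  exact ⟨hq.isOctonionAlgebra (exists_associator_ne_zero hna), hq.isNonAssocDivisionRing⟩

end CentralQuotient

/-! ### Characteristic and the final assembly. -/

theorem exists_add_self_ne_zero {R : Type*} [NonUnitalNonAssocRing R]
    (hexp : AddMonoid.exponent R ≠ 2) (hR : ∃ r : R, r ≠ 0) : ∃ r : R, r + r ≠ 0 := by
  by_contra! h
  obtain ⟨r, hr⟩ := hR
  have h₁ : AddMonoid.exponent R ∣ 2 :=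
    AddMonoid.exponent_dvd_iff_forall_nsmul_eq_zero.mpr fun s => by rw [two_nsmul, h]
  rcases (Nat.dvd_prime Nat.prime_two).mp h₁ with h₂ | h₂
  · have h₃ := AddMonoid.exponent_nsmul_eq_zero r
    rw [h₂, one_nsmul] at h₃
    exact hr h₃
  · exact hexp h₂

theorem theorem1p1 {R : Type*} [NonUnitalNonAssocRing R]
    (halt : IsAlternativeRing R)
    (hnonassoc : ∃ x y z : R, associator x y z ≠ 0)
    (hcomm : ∀ x y : R, x * y - y * x ≠ 0 →
      ¬ IsLeftZeroDivisor (x * y - y * x) ∨ ¬ IsRightZeroDivisor (x * y - y * x))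
    (hassoc : ∀ x : R, ∀ y ∈ commutativeCenter R, ∀ z ∈ commutativeCenter R,
      (x * y) * z = x * (y * z)) :
    (∀ r : R, ¬ IsLeftZeroDivisor r ∧ ¬ IsRightZeroDivisor r) ∧
    (AddMonoid.exponent R ≠ 2 →
      ∃ (_ : NoZeroDivisors R) (_ : Nontrivial (NonUnitalSubring.center R)),
        IsFractionFieldMap (CentralQuotient.ofCenter R) ∧
        IsOctonionAlgebra (Subring.center (CentralQuotient R)) (CentralQuotient R) ∧
        IsNonAssocDivisionRing (CentralQuotient R)) := by
  have hreg : ∀ {a b : R}, a * b = 0 → a = 0 ∨ b = 0 :=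
    halt.mul_eq_zero_of_regular hcomm hnonassoc hassoc
  have hR : HasRegularCommutators R := fun x y r h₁ _ => hreg h₁
  have hsq := halt.commutator_sq_mem_center hR hnonassoc
  have hZ : ∀ x ∉ NonUnitalSubring.center R, ∃ y, x * y - y * x ≠ 0 := fun x =>
    halt.exists_commutator_ne_zero hR hassoc
  refine ⟨fun r => ⟨?_, ?_⟩, fun hexp => ?_⟩
  · rintro ⟨hr, y, hy, hry⟩
    exact (hreg hry).elim hr hy
  · rintro ⟨hr, y, hy, hyr⟩
    exact (hreg hyr).elim hy hr
  · have hnzd : NoZeroDivisors R := ⟨hreg⟩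
    obtain ⟨p, q, s, hp⟩ := hnonassoc
    obtain ⟨y, hy⟩ := hZ p fun hc => hp (sub_eq_zero.mpr (hc.left_assoc q s).symm)
    -- The square of a non-zero commutator is a non-zero central element.
    have hnt : Nontrivial (NonUnitalSubring.center R) :=
      ⟨⟨_, hsq p y⟩, 0, fun h0 => (hreg (congrArg Subtype.val h0)).elim hy hy⟩
    exact ⟨hnzd, hnt, CentralQuotient.isFractionFieldMap,
      CentralQuotient.isOctonionAlgebra_and_isNonAssocDivisionRing halt ⟨p, q, s, hp⟩ hsq hZ
        (exists_add_self_ne_zero hexp ⟨_, hp⟩)⟩
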